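/- Let $M$ be a compact $d$-dimensional Riemannian manifold with Riemannian volume (Lebesgue measure) $m$ and Riemannian distance $\operatorname{dist}$, and let $\Delta\subset M$ be an open topological disk. Let $\mathcal P$ be a countable partition of a subset of $\Delta$ of full Lebesgue measure, and let $F$ be a map, defined on the elements of $\mathcal P$ (and extended measurably in an arbitrary way), such that (i$_1$) (Markov) $F|_\omega\colon\omega\to\Delta$ is a $C^2$ diffeomorphism for each $\omega\in\mathcal P$, the elements $\omega$ being open subsets of $\Delta$; (i$_2$) (uniform expansion) there is $0<\kappa<1$ such that $\|DF(x)^{-1}\|<\kappa$ for every $\omega\in\mathcal P$ and $x\in\omega$; (i$_3$) (bounded distortion) there is $K>0$ such that for every $\omega\in\mathcal P$ and $x,y\in\omega$, with $J_F=|\det DF|$, $$\left|\frac{J_F(x)}{J_F(y)}-1\right|\le K\operatorname{dist}(F(x),F(y)).$$ Let $\mu_F$ be an $F$-invariant Borel probability measure which is absolutely continuous with respect to the Lebesgue measure on $\Delta$. Then $\log J_F\ge 0$ holds $\mu_F$-almost everywhere, and the metric (Kolmogorov–Sinai) entropy of $F$ satisfies $$h_{\mu_F}(F)=\int_\Delta\log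 J_F\,d\mu_F,$$ as an equality in $[0,\infty]$ (both sides may be infinite). -/

import Mathlib

open MeasureTheory Set Filter Bundle Manifold
open scoped ContDiff ENNReal Topology

noncomputable section

/-! ### Jacobians and Riemannian volume -/

/-- `|det A|` for a linear map `A : V → W` between Euclidean spaces of the same dimension, that is
`√(det (A* A))`: the absolute value of the determinant of the matrix of `A` in any orthonormal bases
of `V` and `W`. -/
def absDet {V W : Type*} [NormedAddCommGroup V] [InnerProductSpace ℝ V] [FiniteDimensional ℝ V]
    [NormedAddCommGroup W] [InnerProductSpace ℝ W] [FiniteDimensional ℝ W] (A : V →ₗ[ℝ] W) : ℝ :=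
  Real.sqrt (LinearMap.det (LinearMap.adjoint A ∘ₗ A))

instance tangentSpaceFiniteDimensional {d : ℕ} {M : Type*} [TopologicalSpace M]
    [ChartedSpace (EuclideanSpace ℝ (Fin d)) M] (x : M) :
    FiniteDimensional ℝ (TangentSpace (𝓡 d) x) :=
  inferInstanceAs (FiniteDimensional ℝ (EuclideanSpace ℝ (Fin d)))

section Volume

variable (d : ℕ) {M : Type*} [TopologicalSpace M] [ChartedSpace (EuclideanSpace ℝ (Fin d)) M]
  [RiemannianBundle (fun x : M => TangentSpace (𝓡 d) x)]

/-- The Jacobian `J_F(x) = |det DF(x)|`, with respect to the Riemannian inner products on the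
tangent spaces at `x` and at `F x`. -/
def riemannianJacobian (F : M → M) (x : M) : ℝ :=
  absDet (mfderiv (𝓡 d) (𝓡 d) F x).toLinearMap

/-- The coordinate vector `∂ᵢ` at the point with coordinates `y` in the preferred chart at `p`. -/
def coordVector (p : M) (y : EuclideanSpace ℝ (Fin d)) (i : Fin d) :
    TangentSpace (𝓡 d) ((chartAt (EuclideanSpace ℝ (Fin d)) p).symm y) :=
  mfderiv (𝓡 d) (𝓡 d) (chartAt (EuclideanSpace ℝ (Fin d)) p).symm y
    (EuclideanSpace.single i (1 : ℝ) : EuclideanSpace ℝ (Fin d))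

/-- The classical volume density `√(det (gᵢⱼ))`, `gᵢⱼ = ⟨∂ᵢ, ∂ⱼ⟩`, in the preferred chart at `p`. -/
def volumeDensity (p : M) (y : EuclideanSpace ℝ (Fin d)) : ℝ :=
  Real.sqrt (Matrix.det (Matrix.of fun i j : Fin d =>
    inner ℝ (coordVector d p y i) (coordVector d p y j)))

/-- The Riemannian volume of the domain of the preferred chart `φ` at `p`: the measure
`A ↦ ∫_{φ(A ∩ domain φ)} √(det (gᵢⱼ)) dy`. -/
def chartVolume [MeasurableSpace M] (p : M) : Measure M :=
  Measure.map (chartAt (EuclideanSpace ℝ (Fin d)) p).symm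
    ((volume.restrict (chartAt (EuclideanSpace ℝ (Fin d)) p).target).withDensity
      fun y => ENNReal.ofReal (volumeDensity d p y))

/-- The Riemannian volume (Lebesgue measure) of `M`. The chart measures agree on overlaps of charts,
and their supremum is the measure which restricts to each of them on the domain of the chart. -/
def riemannianVolume (M : Type*) [TopologicalSpace M]
    [ChartedSpace (EuclideanSpace ℝ (Fin d)) M]
    [RiemannianBundle (fun x : M => TangentSpace (𝓡 d) x)] [MeasurableSpace M] : Measure M :=
  ⨆ p : M, chartVolume d p

end Volume

/-! ### Kolmogorov-Sinai entropy -/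

section Entropy

variable {X : Type*} [MeasurableSpace X]

/-- Entropy of the `n`-th refinement `⋁_{i<n} T⁻ⁱ ξ` of a finite partition. A partition into `k`
(possibly empty) pieces is given by its labelling `ξ : X → Fin k`; the pieces of the refinement are
the sets of points with a given `ξ`-itinerary `w` of length `n`. -/
def refinementEntropy (μ : Measure X) (T : X → X) {k : ℕ} (ξ : X → Fin k) (n : ℕ) : ℝ :=
  ∑ w : Fin n → Fin k, Real.negMulLog (μ.real {x | ∀ i : Fin n, ξ (T^[i] x) = w i})

/-- The entropy `h_μ(T, ξ) = lim_n (1/n) H_μ(⋁_{i<n} T⁻ⁱ ξ)`. For invariant probability measures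
the limit exists. -/
def partitionEntropy (μ : Measure X) (T : X → X) {k : ℕ} (ξ : X → Fin k) : ℝ≥0∞ :=
  limsup (fun n : ℕ => ENNReal.ofReal (refinementEntropy μ T ξ n / n)) atTop

/-- The metric (Kolmogorov-Sinai) entropy `h_μ(T) ∈ [0, ∞]`: the supremum of `h_μ(T, ξ)` over all
finite measurable partitions `ξ`. -/
def metricEntropy (μ : Measure X) (T : X → X) : ℝ≥0∞ :=
  ⨆ (k : ℕ) (ξ : X → Fin k) (_ : Measurable ξ), partitionEntropy μ T ξ

end Entropy

/-! ### Piecewise expanding Markov maps -/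

/-- `F` is a piecewise expanding Markov map of the topological disk `Δ`, with the countable
partition `P` of a full Lebesgue measure subset of `Δ` as its partition into domains of smoothness.
Only the values of `F` on the elements of `P` matter. -/
structure IsPiecewiseExpandingMarkov (d : ℕ) {M : Type*} [EMetricSpace M]
    [ChartedSpace (EuclideanSpace ℝ (Fin d)) M]
    [RiemannianBundle (fun x : M => TangentSpace (𝓡 d) x)] [MeasurableSpace M]
    (F : M → M) (Δ : Set M) (P : Set (Set M)) : Prop where
  isOpen_disk : IsOpen Δ
  disk : Nonempty (Δ ≃ₜ Metric.ball (0 : EuclideanSpace ℝ (Fin d)) 1)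
  countable : P.Countable
  subset : ∀ U ∈ P, U ⊆ Δ
  disjoint : P.PairwiseDisjoint id
  full_measure : riemannianVolume d M (Δ \ ⋃₀ P) = 0
  /-- Markov: each `F|U : U → Δ` is a `C²` diffeomorphism. -/
  markov : ∀ U ∈ P, ∃ Φ : PartialDiffeomorph (𝓡 d) (𝓡 d) M M 2,
    Φ.source = U ∧ Φ.target = Δ ∧ EqOn F Φ U
  /-- Uniform expansion, with the operator norm for the Riemannian norms on tangent spaces. -/
  expansion : ∃ κ : ℝ, 0 < κ ∧ κ < 1 ∧ ∀ U ∈ P, ∀ x ∈ U,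
    ‖(mfderiv (𝓡 d) (𝓡 d) F x).inverse‖ < κ
  /-- Bounded distortion. -/
  distortion : ∃ K : ℝ, 0 < K ∧ ∀ U ∈ P, ∀ x ∈ U, ∀ y ∈ U,
    |riemannianJacobian d F x / riemannianJacobian d F y - 1| ≤ K * (edist (F x) (F y)).toReal

end

/-! Write `m` for the volume on `Δ`, `J` for the Jacobian and `h` for the density of `μ`. The
transfer operator equation says that `h y` is the sum of `h x / J x` over the preimages `x` of `y`,
so `h x ≤ J x * h (F x)`, and `g x = h x / (J x * h (F x))` is the conditional probability of the
branch containing `x` given `F x`. Moreover `-log g = log J + log h ∘ F - log h`, that is, `log J`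
plus a coboundary. Since inverse branches contract, `DF` has Jacobian at least `1` and `log J ≥ 0`.

Lower bound. The average of `-log g` is the conditional entropy of the branch partition given the
future. Lumping all but finitely many branches gives finite partitions, whose entropies dominate the
integrals of `-log g` over the retained branches; exhausting the branches gives `∫ -log g ≤ h_μ(F)`.
As `log h` need not be integrable, the coboundary is removed by truncation and Fatou
(`lintegral_le_of_coboundary`).

Upper bound. The branch partition may have infinite entropy, so it is not used directly as a
partition. Given a finite partition `ζ`, Gibbs' inequality compares its itineraries under `μ` with
weights built from `m`: the first `n + j` branch labels of a point predict its `ζ`-itinerary up to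
rare errors, and the `m`-measure of a cylinder is at least about the reciprocal of the Jacobian of
the iterate (`IsFullBranchMap.refinementEntropy_le`). That estimate is bounded distortion.
Distortion is summable when the endpoints lie in a compact `Q ⊆ Δ` of nearly full measure, and
exponential with a fixed rate otherwise; the second case is rare enough to cost an arbitrarily small
rate.

Geometry. Contraction is obtained by lifting paths through inverse branches. The paths must stay in
`Δ`, whose intrinsic diameter may be infinite, hence the compact `Q`. They are chains of `C¹` paths,
because concatenation can create corners. The other geometric input is the change of variables
formula for the Riemannian volume, which turns the Markov map into an `IsFullBranchMap`. -/

noncomputable section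

/-! ### Entropy estimates -/

section EntropyEstimates

variable {X : Type*} [MeasurableSpace X]

/-- The `ξ`-itinerary of length `n` of a point. -/
def itinerary {Y ι : Type*} (T : Y → Y) (ξ : Y → ι) (n : ℕ) (x : Y) : Fin n → ι :=
  fun i => ξ (T^[i] x)

theorem measurable_itinerary {ι : Type*} [MeasurableSpace ι] {T : X → X} {ξ : X → ι}
    (hT : Measurable T) (hξ : Measurable ξ) (n : ℕ) : Measurable (itinerary T ξ n) :=
  measurable_pi_lambda _ fun i => hξ.comp (hT.iterate i)

theorem itinerary_succ {Y ι : Type*} (T : Y → Y) (ξ : Y → ι) (n : ℕ) (x : Y) :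
    itinerary T ξ (n + 1) x = Fin.cons (ξ x) (itinerary T ξ n (T x)) := by
  funext i
  refine Fin.cases ?_ (fun j => ?_) i
  · simp [itinerary]
  · simp [itinerary, Function.iterate_succ_apply]

theorem refinementEntropy_eq_sum_itinerary (μ : Measure X) (T : X → X) {k : ℕ} (ξ : X → Fin k)
    (n : ℕ) : refinementEntropy μ T ξ n
      = ∑ w : Fin n → Fin k, Real.negMulLog (μ.real (itinerary T ξ n ⁻¹' {w})) := by
  unfold refinementEntropy
  congr! 4 with w
  ext x
  simp [itinerary, funext_iff]

theorem sum_setIntegral_fiber {ι : Type*} [Fintype ι] [MeasurableSpace ι]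
    [MeasurableSingletonClass ι] {μ : Measure X} {ξ : X → ι} (hξ : Measurable ξ) {S : Set X}
    (hS : MeasurableSet S) {f : X → ℝ} (hf : Integrable f μ) :
    ∑ a, ∫ x in ξ ⁻¹' {a} ∩ S, f x ∂μ = ∫ x in S, f x ∂μ := by
  rw [← integral_iUnion_fintype (fun a => (hξ (measurableSet_singleton a)).inter hS) ?_
    (fun a => hf.integrableOn)]
  · congr 2
    ext x
    simp
  · intro a b hab
    refine Set.disjoint_left.2 fun x hx hy => hab ?_
    exact hx.1.symm.trans hy.1

theorem sum_measureReal_fiber {ι : Type*} [Fintype ι] [MeasurableSpace ι]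
    [MeasurableSingletonClass ι] {μ : Measure X} [IsFiniteMeasure μ] {ξ : X → ι}
    (hξ : Measurable ξ) {S : Set X} (hS : MeasurableSet S) :
    ∑ a, μ.real (ξ ⁻¹' {a} ∩ S) = μ.real S := by
  simpa using sum_setIntegral_fiber hξ hS (integrable_const (μ := μ) (1 : ℝ))

/-- Jensen's inequality for `log` on `E`: the mean of `log (1 / G)` is at most the log of the mean
of `1 / G`, hence at most `log (μ B / μ E)`. The proof uses the tangent line of `log` at `1`. -/
theorem setIntegral_neg_log_add_le_negMulLog {μ : Measure X} [IsFiniteMeasure μ] {E B : Set X}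
    {G : X → ℝ} (hGm : Measurable G) (hG0 : ∀ x, 0 < G x)
    (hGi : Integrable (fun x => -Real.log (G x)) μ)
    (hEB : μ.real E ≤ μ.real B) (h : ∫⁻ x in E, ENNReal.ofReal (G x)⁻¹ ∂μ ≤ μ B) :
    (∫ x in E, -Real.log (G x) ∂μ) - μ.real E * Real.log (μ.real B)
      ≤ Real.negMulLog (μ.real E) := by
  rcases eq_or_lt_of_le (measureReal_nonneg (μ := μ) (s := E)) with h0 | hq
  · have : μ E = 0 := by simpa [Measure.real, ENNReal.toReal_eq_zero_iff] using h0.symm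
    simp [← h0, Measure.restrict_eq_zero.2 this]
  set q := μ.real E
  set p := μ.real B
  have hp : 0 < p := hq.trans_le hEB
  have hint : IntegrableOn (fun x => (G x)⁻¹) E μ := by
    refine ⟨(hGm.inv).aestronglyMeasurable, ?_⟩
    rw [hasFiniteIntegral_iff_ofReal (Eventually.of_forall fun x => (inv_pos.2 (hG0 x)).le)]
    exact h.trans_lt (measure_lt_top _ _)
  have hle : ∫ x in E, (G x)⁻¹ ∂μ ≤ p := by
    rw [integral_eq_lintegral_of_nonneg_ae
      (Eventually.of_forall fun x => (inv_pos.2 (hG0 x)).le) hint.aestronglyMeasurable]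
    exact ENNReal.toReal_mono (measure_ne_top _ _) h
  have hpt : ∀ x, -Real.log (G x) ≤ q / p * (G x)⁻¹ - (1 + Real.log (q / p)) := by
    intro x
    have h1 := Real.log_le_sub_one_of_pos (mul_pos (div_pos hq hp) (inv_pos.2 (hG0 x)))
    rw [Real.log_mul (div_pos hq hp).ne' (inv_pos.2 (hG0 x)).ne', Real.log_inv] at h1
    linarith
  have h2 : ∫ x in E, -Real.log (G x) ∂μ
      ≤ ∫ x in E, (q / p * (G x)⁻¹ - (1 + Real.log (q / p))) ∂μ :=
    integral_mono hGi.integrableOn ((hint.const_mul _).sub (integrable_const _)) hpt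
  rw [integral_sub (hint.const_mul _) (integrable_const _), integral_const_mul] at h2
  simp only [integral_const, smul_eq_mul, measureReal_restrict_apply_univ] at h2
  have h3 : q / p * ∫ x in E, (G x)⁻¹ ∂μ ≤ q := by
    calc _ ≤ q / p * p := by gcongr
      _ = q := by field_simp
  have hqE : μ.real E = q := rfl
  rw [Real.log_div hq.ne' hp.ne', hqE] at h2
  simp only [Real.negMulLog]
  linarith

theorem integrable_neg_log_of_lintegral_inv {μ : Measure X} [IsFiniteMeasure μ] {G : X → ℝ}
    (hGm : Measurable G) (hG0 : ∀ x, 0 < G x) (hG1 : ∀ x, G x ≤ 1)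
    (h : ∫⁻ x, ENNReal.ofReal (G x)⁻¹ ∂μ < ⊤) : Integrable (fun x => -Real.log (G x)) μ := by
  have hint : Integrable (fun x => (G x)⁻¹) μ := by
    refine ⟨(hGm.inv).aestronglyMeasurable, ?_⟩
    rwa [hasFiniteIntegral_iff_ofReal (Eventually.of_forall fun x => (inv_pos.2 (hG0 x)).le)]
  refine hint.mono (Real.measurable_log.comp hGm).neg.aestronglyMeasurable
    (Eventually.of_forall fun x => ?_)
  have h1 := Real.log_le_sub_one_of_pos (inv_pos.2 (hG0 x))
  rw [Real.log_inv] at h1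
  rw [Real.norm_of_nonneg (neg_nonneg.2 (Real.log_nonpos (hG0 x).le (hG1 x))),
    Real.norm_of_nonneg (inv_pos.2 (hG0 x)).le]
  linarith

/-- An itinerary of length `n + 1` splits into its first symbol `a` and the itinerary `w` of `T x`.
The previous estimate is applied to each cell `ξ⁻¹{a} ∩ T⁻¹B_w` and summed over `a`; by invariance
these cells have total mass `μ B_w`, which reproduces the entropy term of `w`. -/
theorem refinementEntropy_add_le_succ {μ : Measure X} [IsProbabilityMeasure μ] {T : X → X}
    (hT : MeasurePreserving T μ μ) {k : ℕ} {ξ : X → Fin k} (hξ : Measurable ξ) {G : X → ℝ}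
    (hGm : Measurable G) (hG0 : ∀ x, 0 < G x)
    (hGi : Integrable (fun x => -Real.log (G x)) μ)
    (h : ∀ a B, MeasurableSet B →
      ∫⁻ x in ξ ⁻¹' {a} ∩ T ⁻¹' B, ENNReal.ofReal (G x)⁻¹ ∂μ ≤ μ B) (n : ℕ) :
    refinementEntropy μ T ξ n + ∫ x, -Real.log (G x) ∂μ ≤ refinementEntropy μ T ξ (n + 1) := by
  have hI := measurable_itinerary hT.measurable hξ n
  have hB : ∀ w, MeasurableSet (itinerary T ξ n ⁻¹' {w}) := fun w => hI (measurableSet_singleton w)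
  simp only [refinementEntropy_eq_sum_itinerary]
  rw [← (Fin.consEquiv fun _ => Fin k).sum_comp, Fintype.sum_prod_type_right]
  have hcons : ∀ a w, itinerary T ξ (n + 1) ⁻¹' {Fin.cons a w}
      = ξ ⁻¹' {a} ∩ T ⁻¹' (itinerary T ξ n ⁻¹' {w}) := by
    intro a w
    ext x
    simp [itinerary_succ, Fin.cons_inj]
  have hsplit : ∫ x, -Real.log (G x) ∂μ
      = ∑ w, ∫ x in T ⁻¹' (itinerary T ξ n ⁻¹' {w}), -Real.log (G x) ∂μ := by
    have := sum_setIntegral_fiber (hI.comp hT.measurable) MeasurableSet.univ hGi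
    rw [setIntegral_univ] at this
    rw [← this]
    simp [preimage_comp]
  rw [hsplit, ← Finset.sum_add_distrib]
  refine Finset.sum_le_sum fun w _ => ?_
  have hcons' : ∀ a, itinerary T ξ (n + 1) ⁻¹' {Fin.consEquiv (fun _ => Fin k) (a, w)}
      = ξ ⁻¹' {a} ∩ T ⁻¹' (itinerary T ξ n ⁻¹' {w}) := fun a => hcons a w
  simp_rw [hcons']
  have hTB := hT.measurable (hB w)
  have hmeas : μ.real (T ⁻¹' (itinerary T ξ n ⁻¹' {w})) = μ.real (itinerary T ξ n ⁻¹' {w}) :=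
    hT.measureReal_preimage (hB w).nullMeasurableSet
  have hcell : ∀ a, _ := fun a => setIntegral_neg_log_add_le_negMulLog (μ := μ)
    (E := ξ ⁻¹' {a} ∩ T ⁻¹' (itinerary T ξ n ⁻¹' {w})) (B := itinerary T ξ n ⁻¹' {w})
    hGm hG0 hGi
    ((measureReal_mono inter_subset_right).trans hmeas.le) (h a _ (hB w))
  refine le_trans (le_of_eq ?_) (Finset.sum_le_sum fun a _ => hcell a)
  rw [Finset.sum_sub_distrib, ← Finset.sum_mul, sum_setIntegral_fiber hξ hTB hGi,
    sum_measureReal_fiber hξ hTB, hmeas, Real.negMulLog]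
  ring

/-- If `G` is dominated by the conditional probability of the atom of `ξ` given `T⁻¹` of the
`σ`-algebra, then `∫ -log G` is a lower bound for the entropy of `ξ`. -/
theorem lintegral_neg_log_le_partitionEntropy {μ : Measure X} [IsProbabilityMeasure μ] {T : X → X}
    (hT : MeasurePreserving T μ μ) {k : ℕ} {ξ : X → Fin k} (hξ : Measurable ξ) {G : X → ℝ}
    (hGm : Measurable G) (hG0 : ∀ x, 0 < G x) (hG1 : ∀ x, G x ≤ 1)
    (h : ∀ a B, MeasurableSet B →
      ∫⁻ x in ξ ⁻¹' {a} ∩ T ⁻¹' B, ENNReal.ofReal (G x)⁻¹ ∂μ ≤ μ B) :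
    ∫⁻ x, ENNReal.ofReal (-Real.log (G x)) ∂μ ≤ partitionEntropy μ T ξ := by
  -- Taking `B = univ` and summing over the `k` cells bounds the integral of `1 / G` by `k`; this
  -- makes `-log G` integrable without assuming it.
  have hfin : ∫⁻ x, ENNReal.ofReal (G x)⁻¹ ∂μ < ⊤ := by
    have hu : (univ : Set X) = ⋃ a, ξ ⁻¹' {a} ∩ T ⁻¹' univ := by ext x; simp
    rw [← setLIntegral_univ, hu]
    refine (lintegral_iUnion_le _ _).trans_lt ?_
    rw [tsum_fintype]
    exact ENNReal.sum_lt_top.2 fun a _ => (h a univ MeasurableSet.univ).trans_lt (by simp)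
  have hGi := integrable_neg_log_of_lintegral_inv hGm hG0 hG1 hfin
  have hn : ∀ n : ℕ, n * ∫ x, -Real.log (G x) ∂μ ≤ refinementEntropy μ T ξ n := by
    intro n
    induction n with
    | zero => simp [refinementEntropy]
    | succ n ih =>
      have := refinementEntropy_add_le_succ hT hξ hGm hG0 hGi h n
      push_cast
      linarith
  have hpos : ∀ x, 0 ≤ -Real.log (G x) :=
    fun x => neg_nonneg.2 (Real.log_nonpos (hG0 x).le (hG1 x))
  rw [← ofReal_integral_eq_lintegral_ofReal hGi (Eventually.of_forall hpos)]
  refine le_limsup_of_frequently_le (Eventually.frequently ?_)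
  filter_upwards [eventually_gt_atTop 0] with n h0
  refine ENNReal.ofReal_le_ofReal ?_
  rw [le_div_iff₀ (by exact_mod_cast h0), mul_comm]
  exact hn n

/-- Gibbs' inequality, for a finite partition and nonnegative weights `ν`. -/
theorem sum_negMulLog_le {W : Type*} [Fintype W] [MeasurableSpace W] [MeasurableSingletonClass W]
    {μ : Measure X} [IsProbabilityMeasure μ] {ξ : X → W} (hξ : Measurable ξ) {ρ : X → ℝ}
    (hρ0 : ∀ᵐ x ∂μ, 0 < ρ x) (hρi : Integrable (fun x => -Real.log (ρ x)) μ) {ν : W → ℝ}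
    (hν : ∀ w, 0 ≤ ν w) (hρν : ∀ᵐ x ∂μ, ρ x ≤ ν (ξ x)) :
    ∑ w, Real.negMulLog (μ.real (ξ ⁻¹' {w})) ≤ ∫ x, -Real.log (ρ x) ∂μ + ∑ w, ν w := by
  have hsplit : ∫ x, -Real.log (ρ x) ∂μ = ∑ w, ∫ x in ξ ⁻¹' {w}, -Real.log (ρ x) ∂μ := by
    have := sum_setIntegral_fiber hξ MeasurableSet.univ hρi
    rw [setIntegral_univ] at this
    rw [← this]
    simp
  rw [hsplit, ← Finset.sum_add_distrib]
  refine Finset.sum_le_sum fun w _ => ?_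
  set E := ξ ⁻¹' {w} with hEdef
  have hE : MeasurableSet E := hξ (measurableSet_singleton w)
  rcases eq_or_lt_of_le (measureReal_nonneg (μ := μ) (s := E)) with h0 | hq
  · have : μ E = 0 := by simpa [Measure.real, ENNReal.toReal_eq_zero_iff] using h0.symm
    simp [← h0, Measure.restrict_eq_zero.2 this, hν w]
  have hE0 : μ E ≠ 0 := fun h => hq.ne' (by simp [Measure.real, h])
  have hle : ∀ᵐ x ∂μ.restrict E, 0 < ρ x ∧ ρ x ≤ ν w := by
    filter_upwards [ae_restrict_of_ae hρ0, ae_restrict_of_ae hρν, ae_restrict_mem hE]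
      with x h1 h2 h3
    exact ⟨h1, by simpa [show ξ x = w from h3] using h2⟩
  have hνpos : 0 < ν w := by
    have : NeZero (μ.restrict E) := ⟨by simpa using hE0⟩
    obtain ⟨x, hx⟩ := hle.exists
    exact hx.1.trans_le hx.2
  have h1 : ∫ x in E, -Real.log (ν w) ∂μ ≤ ∫ x in E, -Real.log (ρ x) ∂μ := by
    refine integral_mono_ae (integrable_const _) hρi.integrableOn ?_
    filter_upwards [hle] with x hx
    exact neg_le_neg (Real.log_le_log hx.1 hx.2)
  simp only [integral_const, smul_eq_mul, measureReal_restrict_apply_univ] at h1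
  have h2 := Real.log_le_sub_one_of_pos (div_pos hνpos hq)
  rw [Real.log_div hνpos.ne' hq.ne'] at h2
  have h3 : μ.real E * (ν w / μ.real E - 1) = ν w - μ.real E := by field_simp
  have h4 := mul_le_mul_of_nonneg_left h2 hq.le
  rw [h3] at h4
  rw [Real.negMulLog]
  nlinarith

/-- If `b` differs from `a ≥ 0` by a coboundary, then `∫ a ≤ ∫ b`. -/
theorem lintegral_le_of_coboundary {μ : Measure X} [IsProbabilityMeasure μ] {T : X → X}
    (hT : MeasurePreserving T μ μ) {a b u : X → ℝ} (hu : Measurable u) (hb : Measurable b)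
    (ha0 : ∀ᵐ x ∂μ, 0 ≤ a x) (hb0 : ∀ᵐ x ∂μ, 0 ≤ b x)
    (hab : ∀ᵐ x ∂μ, b x = a x + (u (T x) - u x)) :
    ∫⁻ x, ENNReal.ofReal (a x) ∂μ ≤ ∫⁻ x, ENNReal.ofReal (b x) ∂μ := by
  by_cases hfin : ∫⁻ x, ENNReal.ofReal (b x) ∂μ = ⊤
  · simp [hfin]
  have hbi : Integrable b μ := by
    refine ⟨hb.aestronglyMeasurable, ?_⟩
    rw [hasFiniteIntegral_iff_ofReal hb0]
    exact lt_top_iff_ne_top.2 hfin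
  -- Truncation at height `K`. The truncated coboundary is bounded, so it integrates to zero by
  -- invariance although `u` itself may not be integrable; Fatou then handles `K → ∞`.
  set c : ℕ → ℝ → ℝ := fun K t => max (-K) (min K t) with hc
  have hcm : ∀ K, Measurable (c K) := fun K => by fun_prop
  have hcb : ∀ K t, ‖c K t‖ ≤ K := fun K t => by
    have : (0 : ℝ) ≤ K := K.cast_nonneg
    rw [Real.norm_eq_abs, abs_le]
    exact ⟨le_max_left _ _, max_le (by linarith) (min_le_left _ _)⟩
  have hui : ∀ K, Integrable (fun x => c K (u x)) μ := fun K =>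
    (integrable_const (K : ℝ)).mono ((hcm K).comp hu).aestronglyMeasurable
      (Eventually.of_forall fun x => by simpa using hcb K (u x))
  have huTi : ∀ K, Integrable (fun x => c K (u (T x))) μ := fun K =>
    hT.integrable_comp_of_integrable (hui K)
  have hdi : ∀ K, Integrable (fun x => c K (u (T x)) - c K (u x)) μ := fun K =>
    (huTi K).sub (hui K)
  have hzero : ∀ K, ∫ x, (b x - (c K (u (T x)) - c K (u x))) ∂μ = ∫ x, b x ∂μ := by
    intro K
    rw [integral_sub hbi (hdi K), integral_sub (huTi K) (hui K)]
    have : ∫ x, c K (u (T x)) ∂μ = ∫ x, c K (u x) ∂μ := by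
      conv_rhs => rw [← hT.map_eq]
      rw [integral_map hT.measurable.aemeasurable]
      exact ((hcm K).comp hu).aestronglyMeasurable
    rw [this]
    simp
  -- Fatou needs nonnegative functions. Truncation is monotone and 1-Lipschitz: where `u` decreases
  -- along `T` the expression is at least `b`, elsewhere it is at least `a`.
  have hnonneg : ∀ K, ∀ᵐ x ∂μ, 0 ≤ b x - (c K (u (T x)) - c K (u x)) := by
    intro K
    filter_upwards [ha0, hb0, hab] with x h1 h2 h3
    simp only [hc]
    have hK : (0 : ℝ) ≤ K := K.cast_nonneg
    rcases le_total (u (T x)) (u x) with h | h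
    · have : c K (u (T x)) ≤ c K (u x) := max_le_max le_rfl (min_le_min le_rfl h)
      simp only [hc] at this
      linarith
    · have : max (-(K : ℝ)) (min K (u (T x))) ≤ max (-(K : ℝ)) (min K (u x)) + (u (T x) - u x) := by
        refine max_le ?_ ?_
        · have := le_max_left (-(K : ℝ)) (min K (u x))
          linarith
        · have := le_max_right (-(K : ℝ)) (min K (u x))
          rcases le_total (K : ℝ) (u x) with h' | h'
          · rw [min_eq_left h'] at this ⊢
            rw [min_eq_left (h'.trans h)]
            linarith
          · rw [min_eq_right h'] at this ⊢
            have := min_le_right (K : ℝ) (u (T x))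
            linarith
      linarith
  have hlim : ∀ᵐ x ∂μ, Tendsto
      (fun K : ℕ => ENNReal.ofReal (b x - (c K (u (T x)) - c K (u x)))) atTop
      (𝓝 (ENNReal.ofReal (a x))) := by
    filter_upwards [hab] with x hx
    refine tendsto_const_nhds.congr' ?_
    obtain ⟨N, hN⟩ := exists_nat_ge (max |u (T x)| |u x|)
    filter_upwards [eventually_ge_atTop N] with K hK
    have hK' : max |u (T x)| |u x| ≤ (K : ℝ) := hN.trans (by exact_mod_cast hK)
    have e : ∀ t : ℝ, |t| ≤ K → c K t = t := fun t ht => by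
      have := abs_le.1 ht
      simp only [hc]
      rw [min_eq_right this.2, max_eq_right this.1]
    rw [e _ ((le_max_left _ _).trans hK'), e _ ((le_max_right _ _).trans hK'), hx]
    congr 1
    ring
  calc ∫⁻ x, ENNReal.ofReal (a x) ∂μ
      = ∫⁻ x, liminf (fun K : ℕ => ENNReal.ofReal (b x - (c K (u (T x)) - c K (u x)))) atTop ∂μ :=
        lintegral_congr_ae (hlim.mono fun x hx => hx.liminf_eq.symm)
    _ ≤ liminf (fun K : ℕ => ∫⁻ x, ENNReal.ofReal (b x - (c K (u (T x)) - c K (u x))) ∂μ) atTop := by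
        refine lintegral_liminf_le fun K => ?_
        have := hcm K
        have := hT.measurable
        fun_prop
    _ = ∫⁻ x, ENNReal.ofReal (b x) ∂μ := by
        have : ∀ K, ∫⁻ x, ENNReal.ofReal (b x - (c K (u (T x)) - c K (u x))) ∂μ
            = ENNReal.ofReal (∫ x, b x ∂μ) := fun K => by
          rw [← hzero K]
          exact (ofReal_integral_eq_lintegral_ofReal (hbi.sub (hdi K)) (hnonneg K)).symm
        rw [← ofReal_integral_eq_lintegral_ofReal hbi hb0]
        simp [this]

end EntropyEstimates

/-! ### Countable full-branch maps: the lower bound -/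

section FullBranch

variable {X ι : Type*} [MeasurableSpace X] [MeasurableSpace ι]

/-- `F` is a countably-branched map all of whose branches, the fibres of `lab` over the labels in
`good`, are injective and cover the space, with Jacobian `J ≥ 1` with respect to `m`. -/
structure IsFullBranchMap (m : Measure X) (F : X → X) (lab : X → ι) (good : Set ι) (J : X → ℝ) :
    Prop where
  measurable_map : Measurable F
  measurable_label : Measurable lab
  measurable_jacobian : Measurable J
  one_le_jacobian : ∀ x, lab x ∈ good → 1 ≤ J x
  ae_good : ∀ᵐ x ∂m, lab x ∈ good
  injOn : ∀ i ∈ good, InjOn F (lab ⁻¹' {i})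
  lintegral_branch : ∀ i ∈ good, ∀ g : X → ℝ≥0∞, Measurable g →
    ∫⁻ x in lab ⁻¹' {i}, ENNReal.ofReal (J x) * g (F x) ∂m = ∫⁻ x, g x ∂m

variable {m μ : Measure X} {F : X → X} {lab : X → ι} {good : Set ι} {J : X → ℝ}

/-- The density of an absolutely continuous invariant measure is dominated by each term of the
transfer operator. -/
theorem IsFullBranchMap.density_le [StandardBorelSpace X] [Countable ι]
    [MeasurableSingletonClass ι] (hF : IsFullBranchMap m F lab good J)
    [IsFiniteMeasure μ] (hinv : MeasurePreserving F μ μ) {h : X → ℝ} (hm : Measurable h)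
    (hh0 : ∀ x, 0 ≤ h x) (hμ : μ = m.withDensity fun x => ENNReal.ofReal (h x)) :
    ∀ᵐ x ∂μ, h x ≤ J x * h (F x) := by
  have hac : μ ≪ m := hμ ▸ withDensity_absolutelyContinuous _ _
  have hset : ∀ S, MeasurableSet S → μ S = ∫⁻ x in S, ENNReal.ofReal (h x) ∂m := fun S hS => by
    conv_lhs => rw [hμ]
    exact withDensity_apply _ hS
  have hJm := hF.measurable_jacobian
  have hFm := hF.measurable_map
  have key : ∀ i ∈ good, μ (lab ⁻¹' {i} ∩ {x | J x * h (F x) < h x}) = 0 := by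
    intro i hi
    set C := lab ⁻¹' {i} with hC
    have hCm : MeasurableSet C := hF.measurable_label (measurableSet_singleton i)
    set E := C ∩ {x | J x * h (F x) < h x} with hE
    have hEm : MeasurableSet E :=
      hCm.inter (measurableSet_lt (hJm.mul (hm.comp hFm)) hm)
    -- Injective measurable images are measurable in a standard Borel space. Then `μ E ≤ μ (F⁻¹ (F
    -- '' E)) = μ (F '' E)`, and changing variables along the branch makes this the integral of `J *
    -- h ∘ F` over `E`, contradicting the definition of `E` unless `E` is null.
    have hFE : MeasurableSet (F '' E) :=
      hEm.image_of_measurable_injOn hFm ((hF.injOn i hi).mono inter_subset_left)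
    have h1 : μ E ≤ ∫⁻ x in E, ENNReal.ofReal (J x * h (F x)) ∂m := by
      calc μ E ≤ μ (F ⁻¹' (F '' E)) := measure_mono (subset_preimage_image F E)
        _ = μ (F '' E) := hinv.measure_preimage hFE.nullMeasurableSet
        _ = ∫⁻ x, (F '' E).indicator (fun x => ENNReal.ofReal (h x)) x ∂m := by
          rw [hset _ hFE, lintegral_indicator hFE]
        _ = ∫⁻ x in C, ENNReal.ofReal (J x)
              * (F '' E).indicator (fun x => ENNReal.ofReal (h x)) (F x) ∂m :=
          (hF.lintegral_branch i hi _ (hm.ennreal_ofReal.indicator hFE)).symm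
        _ = ∫⁻ x in C, E.indicator (fun x => ENNReal.ofReal (J x * h (F x))) x ∂m := by
          refine setLIntegral_congr_fun hCm fun x hx => ?_
          have hJ : 0 ≤ J x := zero_le_one.trans (hF.one_le_jacobian x (by rwa [show lab x = i from hx]))
          by_cases hxE : x ∈ E
          · simp [hxE, mem_image_of_mem F hxE, ENNReal.ofReal_mul hJ]
          · have : F x ∉ F '' E := by
              rintro ⟨y, hy, hyx⟩
              exact hxE ((hF.injOn i hi hy.1 hx hyx) ▸ hy)
            simp [hxE, this]
        _ = ∫⁻ x in E, ENNReal.ofReal (J x * h (F x)) ∂m := by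
          rw [setLIntegral_indicator hEm, inter_eq_left.2 inter_subset_left]
    by_contra hne
    have hmE : m E ≠ 0 := fun h0 => hne (hac h0)
    have h2 : ∫⁻ x in E, ENNReal.ofReal (J x * h (F x)) ∂m
        < ∫⁻ x in E, ENNReal.ofReal (h x) ∂m := by
      refine setLIntegral_strict_mono hEm hmE hm.ennreal_ofReal ?_ (Eventually.of_forall ?_)
      · refine ne_top_of_le_ne_top (measure_ne_top μ E) ?_
        rw [hset E hEm]
        refine setLIntegral_mono hm.ennreal_ofReal fun x hx => ENNReal.ofReal_le_ofReal hx.2.le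
      · intro x hx
        have hJ : 1 ≤ J x := hF.one_le_jacobian x (by rwa [show lab x = i from hx.1])
        have : 0 ≤ J x * h (F x) := mul_nonneg (by linarith) (hh0 _)
        exact (ENNReal.ofReal_lt_ofReal_iff (this.trans_lt hx.2)).2 hx.2
    rw [← hset E hEm] at h2
    exact absurd h1 (not_le.2 h2)
  have hall : ∀ᵐ x ∂μ, ∀ i ∈ good, x ∉ lab ⁻¹' {i} ∩ {x | J x * h (F x) < h x} :=
    (ae_ball_iff (to_countable good)).2 fun i hi => measure_eq_zero_iff_ae_notMem.1 (key i hi)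
  filter_upwards [hall, hac.ae_le hF.ae_good] with x hx hg
  by_contra hlt
  exact hx _ hg ⟨rfl, not_le.1 hlt⟩

open Classical in
/-- A finite family of labels is a finite measurable partition. -/
theorem exists_finite_label [DiscreteMeasurableSpace ι] (hlab : Measurable lab) (s : Finset ι) :
    ∃ (k : ℕ) (ξ : X → Fin k), Measurable ξ ∧ ∀ a,
      (∀ x ∈ ξ ⁻¹' {a}, lab x ∉ s) ∨ ∃ i, ξ ⁻¹' {a} ⊆ lab ⁻¹' {i} := by
  let e : Option s ≃ Fin (Fintype.card (Option s)) := Fintype.equivFin _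
  let f : ι → Option s := fun i => if h : i ∈ s then some ⟨i, h⟩ else none
  refine ⟨_, fun x => e (f (lab x)), (Measurable.of_discrete (f := fun i => e (f i))).comp hlab, fun a => ?_⟩
  cases hb : e.symm a with
  | none =>
    refine Or.inl fun x hx hs => ?_
    have : f (lab x) = none := by rw [← hb, ← show e (f (lab x)) = a from hx, e.symm_apply_apply]
    simp [f, hs] at this
  | some i =>
    refine Or.inr ⟨i, fun x hx => ?_⟩
    have : f (lab x) = some i := by rw [← hb, ← show e (f (lab x)) = a from hx, e.symm_apply_apply]
    simp only [f] at this
    split_ifs at this with h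
    simpa using congrArg Subtype.val (Option.some.inj this)

-- With `g = h / (J * h ∘ F)` the conditional probability of a branch, `-log g` is cohomologous to
-- `log J`, and its integral is approximated from below by entropies of partitions into finitely
-- many branches and a remainder.
open Classical in
theorem IsFullBranchMap.lintegral_log_jacobian_le_metricEntropy [StandardBorelSpace X] [Countable ι]
    [DiscreteMeasurableSpace ι] (hF : IsFullBranchMap m F lab good J) [IsFiniteMeasure m]
    [IsProbabilityMeasure μ] (hac : μ ≪ m) (hinv : MeasurePreserving F μ μ) :
    ∫⁻ x, ENNReal.ofReal (Real.log (J x)) ∂μ ≤ metricEntropy μ F := by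
  have hJm := hF.measurable_jacobian
  have hFm := hF.measurable_map
  set h : X → ℝ := fun x => (μ.rnDeriv m x).toReal with hh
  have hm : Measurable h := (Measure.measurable_rnDeriv μ m).ennreal_toReal
  have hh0 : ∀ x, 0 ≤ h x := fun x => ENNReal.toReal_nonneg
  have hμ : μ = m.withDensity fun x => ENNReal.ofReal (h x) := by
    conv_lhs => rw [← Measure.withDensity_rnDeriv_eq μ m hac]
    refine withDensity_congr_ae ?_
    filter_upwards [Measure.rnDeriv_lt_top μ m] with x hx
    simp [hh, ENNReal.ofReal_toReal hx.ne]
  have hset : ∀ S, MeasurableSet S → μ S = ∫⁻ x in S, ENNReal.ofReal (h x) ∂m := fun S hS => by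
    conv_lhs => rw [hμ]
    exact withDensity_apply _ hS
  have hpos : ∀ᵐ x ∂μ, 0 < h x := by
    have : μ {x | h x ≤ 0} = 0 := by
      have hS : MeasurableSet {x | h x ≤ 0} := measurableSet_le hm measurable_const
      rw [hset _ hS, setLIntegral_eq_zero_iff hS hm.ennreal_ofReal]
      exact Eventually.of_forall fun x hx => ENNReal.ofReal_of_nonpos hx
    simpa using (measure_eq_zero_iff_ae_notMem.1 this)
  -- A set of full `μ`-measure on which every logarithm below is that of a positive number and `g ≤
  -- 1`; setting `g = 1` elsewhere keeps `0 < g ≤ 1` everywhere.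
  set D : Set X := {x | (lab x ∈ good ∧ 0 < h x) ∧ 0 < h (F x) ∧ h x ≤ J x * h (F x)} with hD
  have hDm : MeasurableSet D := by
    refine ((hF.measurable_label (to_countable good).measurableSet).inter
      (measurableSet_lt measurable_const hm)).inter
      ((measurableSet_lt measurable_const (hm.comp hFm)).inter
        (measurableSet_le hm (hJm.mul (hm.comp hFm))))
  have hDae : ∀ᵐ x ∂μ, x ∈ D := by
    filter_upwards [hpos, hinv.quasiMeasurePreserving.ae hpos, hac.ae_le hF.ae_good,
      hF.density_le hinv hm hh0 hμ] with x h1 h2 h3 h4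
    exact ⟨⟨h3, h1⟩, h2, h4⟩
  have hJD : ∀ x ∈ D, 0 < J x := fun x hx => zero_lt_one.trans_le (hF.one_le_jacobian x hx.1.1)
  set g : X → ℝ := fun x => if x ∈ D then h x / (J x * h (F x)) else 1 with hg
  have hgm : Measurable g :=
    Measurable.ite hDm (hm.div (hJm.mul (hm.comp hFm))) measurable_const
  have hg0 : ∀ x, 0 < g x := by
    intro x
    simp only [hg]
    split_ifs with hx
    · exact div_pos hx.1.2 (mul_pos (hJD x hx) hx.2.1)
    · exact one_pos
  have hg1 : ∀ x, g x ≤ 1 := by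
    intro x
    simp only [hg]
    split_ifs with hx
    · exact (div_le_one (mul_pos (hJD x hx) hx.2.1)).2 hx.2.2
    · exact le_rfl
  -- Against `μ = h m` the integrand `1 / g` becomes `J * h ∘ F`, so the change of variables on the
  -- branch yields the integral of `h` over `B`, which is `μ B`.
  have hcell : ∀ i B, MeasurableSet B →
      ∫⁻ x in lab ⁻¹' {i} ∩ F ⁻¹' B, ENNReal.ofReal (g x)⁻¹ ∂μ ≤ μ B := by
    intro i B hB
    set C := lab ⁻¹' {i} with hC
    have hCm : MeasurableSet C := hF.measurable_label (measurableSet_singleton i)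
    have hSm : MeasurableSet (C ∩ F ⁻¹' B) := hCm.inter (hFm hB)
    have e1 : ∫⁻ x in C ∩ F ⁻¹' B, ENNReal.ofReal (g x)⁻¹ ∂μ
        = ∫⁻ x in (C ∩ F ⁻¹' B) ∩ D, ENNReal.ofReal (g x)⁻¹ ∂μ := by
      refine setLIntegral_congr ?_
      filter_upwards [hDae] with x hx
      simp only [eq_iff_iff]
      exact ⟨fun h => ⟨h, hx⟩, fun h => h.1⟩
    by_cases hi : i ∈ good
    · rw [e1]
      have e2 : ∫⁻ x in (C ∩ F ⁻¹' B) ∩ D, ENNReal.ofReal (g x)⁻¹ ∂μ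
          = ∫⁻ x in (C ∩ F ⁻¹' B) ∩ D,
            ENNReal.ofReal (J x) * B.indicator (fun y => ENNReal.ofReal (h y)) (F x) ∂m := by
        have hgi : Measurable fun x => ENNReal.ofReal (g x)⁻¹ := hgm.inv.ennreal_ofReal
        conv_lhs => rw [hμ]
        rw [setLIntegral_withDensity_eq_setLIntegral_mul _ hm.ennreal_ofReal hgi (hSm.inter hDm)]
        refine setLIntegral_congr_fun (hSm.inter hDm) fun x hx => ?_
        have hJx := hJD x hx.2
        have hFx : F x ∈ B := hx.1.2
        have hxp : 0 < h x := hx.2.1.2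
        simp only [Pi.mul_apply, hg, if_pos hx.2, indicator_of_mem hFx]
        rw [← ENNReal.ofReal_mul hxp.le, ← ENNReal.ofReal_mul hJx.le]
        congr 1
        have := hx.2.2.1
        field_simp
      rw [e2]
      calc _ ≤ ∫⁻ x in C, ENNReal.ofReal (J x)
              * B.indicator (fun y => ENNReal.ofReal (h y)) (F x) ∂m :=
            lintegral_mono_set fun x hx => hx.1.1
        _ = ∫⁻ x, B.indicator (fun y => ENNReal.ofReal (h y)) x ∂m :=
            hF.lintegral_branch i hi _ (hm.ennreal_ofReal.indicator hB)
        _ = μ B := by rw [lintegral_indicator hB, hset B hB]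
    · have : (C ∩ F ⁻¹' B) ∩ D = ∅ := by
        ext x
        simp only [mem_inter_iff, mem_empty_iff_false, iff_false, not_and]
        rintro ⟨hx, -⟩ hxD
        exact hi ((show lab x = i from hx) ▸ hxD.1.1)
      rw [e1, this]
      simp
  have hfin : ∀ s : Finset ι, ∫⁻ x in lab ⁻¹' s, ENNReal.ofReal (-Real.log (g x)) ∂μ
      ≤ metricEntropy μ F := by
    intro s
    obtain ⟨k, ξ, hξ, hξs⟩ := exists_finite_label hF.measurable_label s
    have hsm : MeasurableSet (lab ⁻¹' (s : Set ι)) := hF.measurable_label s.measurableSet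
    -- On the lumped remainder cell the conditional probability is replaced by the trivial bound
    -- `1`, which contributes nothing to `-log G`.
    set G : X → ℝ := fun x => if x ∈ lab ⁻¹' (s : Set ι) then g x else 1 with hG
    have hGm : Measurable G := Measurable.ite hsm hgm measurable_const
    have hG0 : ∀ x, 0 < G x := fun x => by simp only [hG]; split_ifs; exacts [hg0 x, one_pos]
    have hG1 : ∀ x, G x ≤ 1 := fun x => by simp only [hG]; split_ifs; exacts [hg1 x, le_rfl]
    have hGg : ∀ x, (G x)⁻¹ ≤ (g x)⁻¹ := fun x => by
      simp only [hG]
      split_ifs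
      · exact le_rfl
      · simpa using one_le_inv_iff₀.2 ⟨hg0 x, hg1 x⟩
    have hmain := lintegral_neg_log_le_partitionEntropy hinv hξ hGm hG0 hG1 (fun a B hB => by
      rcases hξs a with h | ⟨i, hi⟩
      · calc ∫⁻ x in ξ ⁻¹' {a} ∩ F ⁻¹' B, ENNReal.ofReal (G x)⁻¹ ∂μ
            = ∫⁻ x in ξ ⁻¹' {a} ∩ F ⁻¹' B, 1 ∂μ := by
              refine setLIntegral_congr_fun ((hξ (measurableSet_singleton a)).inter (hFm hB))
                fun x hx => ?_
              have : x ∉ lab ⁻¹' (s : Set ι) := h x hx.1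
              simp only [hG, if_neg this]
              simp
          _ ≤ μ (F ⁻¹' B) := by
              rw [setLIntegral_one]
              exact measure_mono inter_subset_right
          _ = μ B := hinv.measure_preimage hB.nullMeasurableSet
      · calc ∫⁻ x in ξ ⁻¹' {a} ∩ F ⁻¹' B, ENNReal.ofReal (G x)⁻¹ ∂μ
            ≤ ∫⁻ x in lab ⁻¹' {i} ∩ F ⁻¹' B, ENNReal.ofReal (G x)⁻¹ ∂μ :=
              lintegral_mono_set (inter_subset_inter_left _ hi)
          _ ≤ ∫⁻ x in lab ⁻¹' {i} ∩ F ⁻¹' B, ENNReal.ofReal (g x)⁻¹ ∂μ :=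
              lintegral_mono fun x => ENNReal.ofReal_le_ofReal (hGg x)
          _ ≤ μ B := hcell i B hB)
    calc ∫⁻ x in lab ⁻¹' s, ENNReal.ofReal (-Real.log (g x)) ∂μ
        = ∫⁻ x in lab ⁻¹' s, ENNReal.ofReal (-Real.log (G x)) ∂μ :=
          setLIntegral_congr_fun hsm fun x hx => by simp only [hG, if_pos hx]
      _ ≤ ∫⁻ x, ENNReal.ofReal (-Real.log (G x)) ∂μ := setLIntegral_le_lintegral _ _
      _ ≤ partitionEntropy μ F ξ := hmain
      _ ≤ metricEntropy μ F := le_iSup₂_of_le k ξ (le_iSup_of_le hξ le_rfl)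
  have hsup : ∫⁻ x, ENNReal.ofReal (-Real.log (g x)) ∂μ ≤ metricEntropy μ F := by
    have hCm : ∀ i, MeasurableSet (lab ⁻¹' {i}) :=
      fun i => hF.measurable_label (measurableSet_singleton i)
    have hdisj : Pairwise (Function.onFun Disjoint fun i => lab ⁻¹' {i}) := fun i j hij =>
      Set.disjoint_left.2 fun x hx hy => hij (hx.symm.trans hy)
    have hu : (univ : Set X) = ⋃ i, lab ⁻¹' {i} := by ext x; simp
    rw [← setLIntegral_univ, hu, lintegral_iUnion hCm hdisj, ENNReal.tsum_eq_iSup_sum]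
    refine iSup_le fun s => le_trans (le_of_eq ?_) (hfin s)
    rw [← lintegral_biUnion_finset (hdisj.set_pairwise _) (fun i _ => hCm i)]
    congr 2
    ext x
    simp
  refine le_trans ?_ hsup
  refine lintegral_le_of_coboundary hinv (u := fun x => Real.log (h x))
    (Real.measurable_log.comp hm) (Real.measurable_log.comp hgm).neg ?_ ?_ ?_
  · filter_upwards [hDae] with x hx
    exact Real.log_nonneg (hF.one_le_jacobian x hx.1.1)
  · exact Eventually.of_forall fun x => neg_nonneg.2 (Real.log_nonpos (hg0 x).le (hg1 x))
  · filter_upwards [hDae] with x hx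
    have h1 := hx.1.2.ne'
    have h2 := hx.2.1.ne'
    have h3 := (hJD x hx).ne'
    simp only [hg, if_pos hx]
    rw [Real.log_div h1 (mul_ne_zero h3 h2), Real.log_mul h3 h2]
    ring

end FullBranch

/-! ### Countable full-branch maps: the upper bound -/

section UpperBound

/-- The product of `J` along an orbit segment of length `n`. -/
def orbitProd {Y : Type*} (F : Y → Y) (J : Y → ℝ) (n : ℕ) (x : Y) : ℝ :=
  ∏ i ∈ Finset.range n, J (F^[i] x)

theorem orbitProd_succ {Y : Type*} (F : Y → Y) (J : Y → ℝ) (n : ℕ) (x : Y) :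
    orbitProd F J (n + 1) x = J x * orbitProd F J n (F x) := by
  simp [orbitProd, Finset.prod_range_succ', Function.iterate_succ_apply, mul_comm]

theorem itinerary_add_congr {Y ι : Type*} {F : Y → Y} {lab : Y → ι} {n j : ℕ} {x y : Y}
    (h : itinerary F lab (n + j) x = itinerary F lab (n + j) y) {i : ℕ} (hi : i ≤ n) :
    itinerary F lab j (F^[i] x) = itinerary F lab j (F^[i] y) := by
  funext l
  have := congrFun h ⟨l + i, by omega⟩
  simpa [itinerary, ← Function.iterate_add_apply] using this

theorem orbitProd_le_mul_orbitProd {Y ι : Type*} {F : Y → Y} {lab : Y → ι} {good : Set ι}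
    {J : Y → ℝ} (hJ1 : ∀ x, lab x ∈ good → 1 ≤ J x) {n : ℕ} {x y : Y}
    (hx : ∀ i, itinerary F lab n x i ∈ good) (hxy : itinerary F lab n x = itinerary F lab n y)
    {a : ℕ → ℝ} (ha : ∀ i < n, J (F^[i] y) ≤ J (F^[i] x) * a i) :
    orbitProd F J n y ≤ (∏ i ∈ Finset.range n, a i) * orbitProd F J n x := by
  rw [orbitProd, orbitProd, ← Finset.prod_mul_distrib]
  refine Finset.prod_le_prod (fun i hi => ?_) (fun i hi => ?_)
  · have hi := Finset.mem_range.1 hi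
    refine zero_le_one.trans (hJ1 _ ?_)
    have h1 := congrFun hxy ⟨i, hi⟩
    have h2 := hx ⟨i, hi⟩
    rw [h1] at h2
    exact h2
  · rw [mul_comm]
    exact ha i (Finset.mem_range.1 hi)

variable {X ι : Type*} [MeasurableSpace X] [MeasurableSpace ι]
variable {m μ : Measure X} {F : X → X} {lab : X → ι} {good : Set ι} {J : X → ℝ}

theorem IsFullBranchMap.measurable_orbitProd (hF : IsFullBranchMap m F lab good J) (n : ℕ) :
    Measurable (orbitProd F J n) :=
  Finset.measurable_prod _ fun i _ => hF.measurable_jacobian.comp (hF.measurable_map.iterate i)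

theorem IsFullBranchMap.one_le_orbitProd (hF : IsFullBranchMap m F lab good J) {n : ℕ} {x : X}
    (hx : ∀ i, itinerary F lab n x i ∈ good) : 1 ≤ orbitProd F J n x := by
  exact Finset.one_le_prod fun i hi => hF.one_le_jacobian _ (hx ⟨i, Finset.mem_range.1 hi⟩)

/-- By iterating the branch formula, `F^[n]` restricted to a cylinder of length `n` is again a full
branch, with Jacobian `orbitProd F J n`. -/
theorem IsFullBranchMap.lintegral_cylinder [Countable ι] [DiscreteMeasurableSpace ι]
    (hF : IsFullBranchMap m F lab good J) (n : ℕ) (w : Fin n → ι) (hw : ∀ i, w i ∈ good)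
    {g : X → ℝ≥0∞} (hg : Measurable g) :
    ∫⁻ x in itinerary F lab n ⁻¹' {w}, ENNReal.ofReal (orbitProd F J n x) * g (F^[n] x) ∂m
      = ∫⁻ x, g x ∂m := by
  induction n with
  | zero =>
    have : itinerary F lab 0 ⁻¹' {w} = univ := by
      ext x
      simp [eq_iff_true_of_subsingleton]
    simp [this, orbitProd]
  | succ n ih =>
    have hI := measurable_itinerary hF.measurable_map hF.measurable_label n
    have hS : MeasurableSet (itinerary F lab n ⁻¹' {Fin.tail w}) := hI (measurableSet_singleton _)
    have hC : MeasurableSet (lab ⁻¹' {w 0}) := hF.measurable_label (measurableSet_singleton _)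
    have hset : itinerary F lab (n + 1) ⁻¹' {w}
        = F ⁻¹' (itinerary F lab n ⁻¹' {Fin.tail w}) ∩ lab ⁻¹' {w 0} := by
      ext x
      conv_lhs => rw [← Fin.cons_self_tail w]
      simp only [itinerary_succ, mem_preimage, mem_singleton_iff, Fin.cons_inj, mem_inter_iff]
      exact and_comm
    have hG : Measurable ((itinerary F lab n ⁻¹' {Fin.tail w}).indicator
        fun y => ENNReal.ofReal (orbitProd F J n y) * g (F^[n] y)) :=
      ((hF.measurable_orbitProd n).ennreal_ofReal.mul
        (hg.comp (hF.measurable_map.iterate n))).indicator hS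
    rw [hset, ← setLIntegral_indicator (hF.measurable_map hS), ← ih (Fin.tail w) (fun i => hw _),
      ← lintegral_indicator hS, ← hF.lintegral_branch (w 0) (hw 0) _ hG]
    refine setLIntegral_congr_fun hC fun x hx => ?_
    have hJ : 0 ≤ J x := zero_le_one.trans (hF.one_le_jacobian x (by
      rw [show lab x = w 0 from hx]; exact hw 0))
    by_cases h : F x ∈ itinerary F lab n ⁻¹' {Fin.tail w}
    · have h' : x ∈ F ⁻¹' (itinerary F lab n ⁻¹' {Fin.tail w}) := h
      rw [indicator_of_mem h, indicator_of_mem h', orbitProd_succ, ENNReal.ofReal_mul hJ, mul_assoc,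
        Function.iterate_succ_apply]
    · have h' : x ∉ F ⁻¹' (itinerary F lab n ⁻¹' {Fin.tail w}) := h
      rw [indicator_of_notMem h, indicator_of_notMem h', mul_zero]

/-- How distortion becomes a lower bound on the measure of a cylinder: integrate the indicator of
`B` in the cylinder formula and bound the Jacobian by `c`. -/
theorem IsFullBranchMap.measureReal_le_mul_cylinder [Countable ι] [DiscreteMeasurableSpace ι]
    (hF : IsFullBranchMap m F lab good J) [IsFiniteMeasure m] {n : ℕ} {w : Fin n → ι}
    (hw : ∀ i, w i ∈ good) {B : Set X} (hB : MeasurableSet B) {c : ℝ} (hc : 0 ≤ c)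
    (hJ : ∀ y, itinerary F lab n y = w → F^[n] y ∈ B → orbitProd F J n y ≤ c) :
    m.real B ≤ c * m.real (itinerary F lab n ⁻¹' {w}) := by
  have hI := measurable_itinerary hF.measurable_map hF.measurable_label n
  have h := hF.lintegral_cylinder n w hw (g := B.indicator 1) (measurable_one.indicator hB)
  rw [lintegral_indicator_one hB] at h
  have h2 : m B ≤ ENNReal.ofReal c * m (itinerary F lab n ⁻¹' {w}) := by
    rw [← h, ← setLIntegral_const]
    refine setLIntegral_mono measurable_const fun y hy => ?_
    by_cases hyB : F^[n] y ∈ B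
    · simpa [hyB] using ENNReal.ofReal_le_ofReal (hJ y hy hyB)
    · simp [hyB]
  have h3 := ENNReal.toReal_mono (ENNReal.mul_ne_top ENNReal.ofReal_ne_top (measure_ne_top _ _)) h2
  rwa [ENNReal.toReal_mul, ENNReal.toReal_ofReal hc] at h3

end UpperBound

/-! ### Distortion of iterates, and approximation of finite partitions by cylinders. -/

section UpperBound

variable {X ι : Type*} {F : X → X} {lab : X → ι} {good : Set ι} {J : X → ℝ}

/-- On the set `Q`, the inverse branches contract at an exponential rate. -/
def ContractsOn [EDist X] (F : X → X) (lab : X → ι) (good : Set ι) (κ L : ℝ) (Q : Set X) : Prop :=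
  ∀ (n : ℕ) (x y : X), (∀ i, itinerary F lab n x i ∈ good) →
    itinerary F lab n x = itinerary F lab n y → F^[n] x ∈ Q → F^[n] y ∈ Q →
    ∀ i ≤ n, edist (F^[i] x) (F^[i] y) ≤ ENNReal.ofReal (κ ^ (n - i) * L)

/-- Bounded distortion of iterates. -/
theorem orbitProd_le_exp_mul [EDist X] (hJ1 : ∀ x, lab x ∈ good → 1 ≤ J x) {κ L K : ℝ}
    (hκ0 : 0 < κ) (hκ1 : κ < 1) (hL0 : 0 ≤ L) (hK : 0 ≤ K)
    (hdist : ∀ x y, lab x ∈ good → lab x = lab y →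
      J y ≤ J x * (1 + K * (edist (F x) (F y)).toReal))
    {Q : Set X} (hL : ContractsOn F lab good κ L Q) {n : ℕ} {x y : X}
    (hx : ∀ i, itinerary F lab n x i ∈ good) (hxy : itinerary F lab n x = itinerary F lab n y)
    (hxQ : F^[n] x ∈ Q) (hyQ : F^[n] y ∈ Q) :
    orbitProd F J n y ≤ Real.exp (K * L * (1 - κ)⁻¹) * orbitProd F J n x := by
  -- The factor at time `i` involves the distance at time `i + 1`, at most `κ ^ (n - 1 - i) * L`;
  -- with `1 + t ≤ exp t` the product is controlled by a geometric series.
  have h1 := orbitProd_le_mul_orbitProd hJ1 hx hxy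
    (a := fun i => 1 + K * (edist (F^[i + 1] x) (F^[i + 1] y)).toReal) (fun i hi => by
      have := hdist (F^[i] x) (F^[i] y) (hx ⟨i, hi⟩) (congrFun hxy ⟨i, hi⟩)
      simpa only [← Function.iterate_succ_apply'] using this)
  refine h1.trans (mul_le_mul_of_nonneg_right ?_ ?_)
  · calc ∏ i ∈ Finset.range n, (1 + K * (edist (F^[i + 1] x) (F^[i + 1] y)).toReal)
        ≤ ∏ i ∈ Finset.range n, Real.exp (K * L * κ ^ (n - 1 - i)) := by
          refine Finset.prod_le_prod (fun i _ => by positivity) (fun i hi => ?_)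
          have hi := Finset.mem_range.1 hi
          have h2 := hL n x y hx hxy hxQ hyQ (i + 1) hi
          have h3 : (edist (F^[i + 1] x) (F^[i + 1] y)).toReal ≤ κ ^ (n - (i + 1)) * L :=
            ENNReal.toReal_le_of_le_ofReal (by positivity) h2
          rw [show n - (i + 1) = n - 1 - i by omega] at h3
          calc _ ≤ 1 + K * (κ ^ (n - 1 - i) * L) := by gcongr
            _ = K * L * κ ^ (n - 1 - i) + 1 := by ring
            _ ≤ _ := Real.add_one_le_exp _
      _ = Real.exp (K * L * ∑ i ∈ Finset.range n, κ ^ i) := by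
          rw [← Real.exp_sum, ← Finset.mul_sum, Finset.sum_range_reflect (fun i => κ ^ i)]
      _ ≤ Real.exp (K * L * (1 - κ)⁻¹) := by
          rw [← tsum_geometric_of_lt_one hκ0.le hκ1]
          gcongr
          exact (summable_geometric_of_lt_one hκ0.le hκ1).sum_le_tsum _ fun i _ => by positivity
  · exact Finset.prod_nonneg fun i hi => zero_le_one.trans (hJ1 _ (hx ⟨i, Finset.mem_range.1 hi⟩))

/-- The crude bound, exponential in `n`, for orbit segments whose endpoint lies outside `Q`. -/
theorem orbitProd_le_pow_mul [EDist X] (hJ1 : ∀ x, lab x ∈ good → 1 ≤ J x) {K D : ℝ}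
    (hK : 0 ≤ K) (hD : ∀ x y : X, (edist x y).toReal ≤ D)
    (hdist : ∀ x y, lab x ∈ good → lab x = lab y →
      J y ≤ J x * (1 + K * (edist (F x) (F y)).toReal)) {n : ℕ} {x y : X}
    (hx : ∀ i, itinerary F lab n x i ∈ good) (hxy : itinerary F lab n x = itinerary F lab n y) :
    orbitProd F J n y ≤ (1 + K * D) ^ n * orbitProd F J n x := by
  have h1 := orbitProd_le_mul_orbitProd hJ1 hx hxy (a := fun _ => 1 + K * D) (fun i hi => by
      have := hdist (F^[i] x) (F^[i] y) (hx ⟨i, hi⟩) (congrFun hxy ⟨i, hi⟩)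
      refine this.trans (mul_le_mul_of_nonneg_left ?_ (zero_le_one.trans (hJ1 _ (hx ⟨i, hi⟩))))
      gcongr
      exact hD _ _)
  simpa using h1

variable [MeasurableSpace X] {μ : Measure X}

/-- The partition into branches generates modulo `μ`. -/
theorem exists_approx_label [EMetricSpace X] [CompactSpace X] [BorelSpace X]
    [IsProbabilityMeasure μ] (hinv : MeasurePreserving F μ μ)
    (hgood : ∀ n, ∀ᵐ x ∂μ, ∀ i, itinerary F lab n x i ∈ good)
    {κ : ℝ} (hκ0 : 0 < κ) (hκ1 : κ < 1) {ε L : ℝ} (hε : 0 < ε) {Q : Set X} (hQm : MeasurableSet Q)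
    (hQ : μ.real Qᶜ ≤ ε) (hL : ContractsOn F lab good κ L Q)
    {k : ℕ} {ζ : X → Fin k} (hζ : Measurable ζ) :
    ∃ (j : ℕ) (θ : (Fin j → ι) → Fin k), μ.real {x | θ (itinerary F lab j x) ≠ ζ x} ≤ 2 * ε := by
  have hne : Nonempty X := nonempty_of_isProbabilityMeasure μ
  have hk : Nonempty (Fin k) := hne.map ζ
  have hk0 : (0 : ℝ) < k := by
    have := Fin.pos hk.some
    exact_mod_cast this
  have hA : ∀ a, MeasurableSet (ζ ⁻¹' {a}) := fun a => hζ (measurableSet_singleton a)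
  have hδ : ENNReal.ofReal (ε / k) ≠ 0 := by simpa using div_pos hε hk0
  -- Closed inner approximations of the pieces of `ζ`. They are compact and disjoint, hence
  -- separated by a positive distance, which for large `j` exceeds the diameter `κ ^ j * L` of a
  -- cylinder intersected with `F^[j]⁻¹ Q`.
  choose A hAsub hAc hAμ using fun a =>
    (hA a).exists_isClosed_sdiff_lt (μ := μ) (measure_ne_top _ _) hδ
  have hsep : ∀ p : Fin k × Fin k, p.1 ≠ p.2 → ∃ δ : ℝ, 0 < δ ∧
      Disjoint (Metric.thickening δ (A p.1)) (Metric.thickening δ (A p.2)) := fun p hp =>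
    Disjoint.exists_thickenings (Set.disjoint_left.2 fun x hx hy =>
      hp ((hAsub _ hx).symm.trans (hAsub _ hy))) (hAc _).isCompact (hAc _)
  have hlim : Tendsto (fun j : ℕ => κ ^ j * L) atTop (𝓝 0) := by
    simpa using (tendsto_pow_atTop_nhds_zero_of_lt_one hκ0.le hκ1).mul_const L
  have hev : ∀ p : Fin k × Fin k, ∀ᶠ j : ℕ in atTop, ∀ x ∈ A p.1, ∀ y ∈ A p.2,
      edist x y ≤ ENNReal.ofReal (κ ^ j * L) → p.1 = p.2 := by
    intro p
    by_cases hp : p.1 = p.2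
    · exact Eventually.of_forall fun j x _ y _ _ => hp
    obtain ⟨δ, hδ0, hdis⟩ := hsep p hp
    filter_upwards [hlim.eventually (gt_mem_nhds hδ0)] with j hj x hx y hy hxy
    have h1 : x ∈ Metric.thickening δ (A p.1) := Metric.self_subset_thickening hδ0 _ hx
    have h2 : x ∈ Metric.thickening δ (A p.2) :=
      (Metric.mem_thickening_iff_exists_edist_lt _ _).2
        ⟨y, hy, hxy.trans_lt ((ENNReal.ofReal_lt_ofReal_iff hδ0).2 hj)⟩
    exact absurd h2 (Set.disjoint_left.1 hdis h1)
  obtain ⟨j, hj⟩ := (eventually_all.2 hev).exists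
  classical
  -- At most one `a` is related to a good `w`, and `θ w` is that one. A wrong guess at `x` forces
  -- `F^[j] x ∉ Q` or `x ∉ A (ζ x)`; each event has measure at most `ε`.
  let R : (Fin j → ι) → Fin k → Prop := fun w a =>
    ∃ y, itinerary F lab j y = w ∧ F^[j] y ∈ Q ∧ y ∈ A a
  refine ⟨j, fun w => if h : ∃ a, R w a then h.choose else hk.some, ?_⟩
  have hkey : ∀ x, (∀ i, itinerary F lab j x i ∈ good) → F^[j] x ∈ Q → x ∈ A (ζ x) →
      (if h : ∃ a, R (itinerary F lab j x) a then h.choose else hk.some) = ζ x := by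
    intro x hx hxQ hxA
    have h : ∃ a, R (itinerary F lab j x) a := ⟨ζ x, x, rfl, hxQ, hxA⟩
    rw [dif_pos h]
    obtain ⟨y, hy, hyQ, hyA⟩ := h.choose_spec
    refine (hj (ζ x, h.choose) x hxA y hyA ?_).symm
    simpa using hL j x y hx hy.symm hxQ hyQ 0 (Nat.zero_le _)
  have hsub : {x | (if h : ∃ a, R (itinerary F lab j x) a then h.choose else hk.some) ≠ ζ x}
      ≤ᵐ[μ] (F^[j] ⁻¹' Qᶜ ∪ ⋃ a, ζ ⁻¹' {a} \ A a : Set X) := by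
    filter_upwards [hgood j] with x hx hne
    by_contra hcon
    have hcon : ¬ (x ∈ (F^[j] ⁻¹' Qᶜ ∪ ⋃ a, ζ ⁻¹' {a} \ A a : Set X)) := hcon
    simp only [mem_union, mem_preimage, mem_compl_iff, mem_iUnion, Set.mem_sdiff, mem_singleton_iff,
      not_or, not_not, not_exists, not_and] at hcon
    exact hne (hkey x hx hcon.1 (hcon.2 _ rfl))
  calc μ.real _ ≤ μ.real (F^[j] ⁻¹' Qᶜ ∪ ⋃ a, ζ ⁻¹' {a} \ A a : Set X) :=
        ENNReal.toReal_mono (measure_ne_top _ _) (measure_mono_ae hsub)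
    _ ≤ μ.real (F^[j] ⁻¹' Qᶜ) + μ.real (⋃ a, ζ ⁻¹' {a} \ A a) := measureReal_union_le _ _
    _ ≤ ε + ε := by
        gcongr
        · rw [(hinv.iterate j).measureReal_preimage hQm.compl.nullMeasurableSet]
          exact hQ
        · calc μ.real (⋃ a, ζ ⁻¹' {a} \ A a) ≤ ∑ a, μ.real (ζ ⁻¹' {a} \ A a) :=
              measureReal_iUnion_fintype_le _
            _ ≤ ∑ a : Fin k, ε / k := by
              refine Finset.sum_le_sum fun a _ => ?_
              exact ENNReal.toReal_le_of_le_ofReal (div_pos hε hk0).le (hAμ a).le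
            _ = ε := by
              simp only [Finset.sum_const, Finset.card_univ, Fintype.card_fin, nsmul_eq_mul]
              field_simp
    _ = 2 * ε := by ring

end UpperBound

/-! ### Entropy of a finite partition bounded through cylinder measures. -/

section UpperBound

variable {X ι : Type*} [MeasurableSpace X] [MeasurableSpace ι]
variable {m μ : Measure X} {F : X → X} {lab : X → ι} {good : Set ι} {J : X → ℝ}

theorem integral_sum_iterate [IsFiniteMeasure μ] (hinv : MeasurePreserving F μ μ) {f : X → ℝ}
    (hf : Integrable f μ) (n : ℕ) :
    Integrable (fun x => ∑ i ∈ Finset.range n, f (F^[i] x)) μ ∧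
      ∫ x, ∑ i ∈ Finset.range n, f (F^[i] x) ∂μ = n * ∫ x, f x ∂μ := by
  have hi : ∀ i, Integrable (fun x => f (F^[i] x)) μ := fun i =>
    (hinv.iterate i).integrable_comp_of_integrable hf
  refine ⟨integrable_finsetSum _ fun i _ => hi i, ?_⟩
  rw [integral_finsetSum _ fun i _ => hi i]
  have : ∀ i, ∫ x, f (F^[i] x) ∂μ = ∫ x, f x ∂μ := fun i => by
    conv_rhs => rw [← (hinv.iterate i).map_eq]
    rw [integral_map (hinv.iterate i).measurable.aemeasurable]
    rw [(hinv.iterate i).map_eq]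
    exact hf.aestronglyMeasurable
  simp [this]

/-- `E a b` is the cost of encoding the symbol `b` when `a` was predicted, and `hE` is a Kraft
inequality. Averaging the resulting code over `m` gives weights on `ζ`-itineraries, to which Gibbs'
inequality applies. The weight of the itinerary of `x` is bounded below by the contribution of the
single cylinder containing `x`. No entropy of the countable branch partition appears. -/
theorem IsFullBranchMap.refinementEntropy_le [Countable ι] [DiscreteMeasurableSpace ι]
    (hF : IsFullBranchMap m F lab good J) [IsFiniteMeasure m] [IsProbabilityMeasure μ]
    (hinv : MeasurePreserving F μ μ) (hgood : ∀ n, ∀ᵐ x ∂μ, ∀ i, itinerary F lab n x i ∈ good)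
    (hJi : Integrable (fun x => Real.log (J x)) μ) {k : ℕ} {ζ : X → Fin k} (hζ : Measurable ζ)
    {E : Fin k → Fin k → ℝ} (hE : ∀ a, ∑ b, Real.exp (-E a b) ≤ 1) {n j : ℕ}
    (θ : (Fin j → ι) → Fin k) {ψ : X → ℝ} (hψ : Integrable ψ μ)
    (hcyl : ∀ x, (∀ i, itinerary F lab (n + j) x i ∈ good) → Real.exp (-ψ (F^[n + j] x))
      ≤ orbitProd F J (n + j) x
        * m.real (itinerary F lab (n + j) ⁻¹' {itinerary F lab (n + j) x})) :
    refinementEntropy μ F ζ n ≤ ∫ x, ψ x ∂μ + (n + j : ℕ) * ∫ x, Real.log (J x) ∂μ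
      + n * ∫ x, E (θ (itinerary F lab j x)) (ζ x) ∂μ + m.real univ := by
  have hFm := hF.measurable_map
  have hIj := measurable_itinerary hFm hF.measurable_label j
  have hIN := measurable_itinerary hFm hF.measurable_label (n + j)
  have hθ : Measurable fun x => θ (itinerary F lab j x) := (Measurable.of_discrete (f := θ)).comp hIj
  set f : X → ℝ := fun x => E (θ (itinerary F lab j x)) (ζ x) with hf
  have hpair : Measurable fun x => (θ (itinerary F lab j x), ζ x) := hθ.prodMk hζ
  have hfm : Measurable f :=
    (Measurable.of_discrete (f := fun p : Fin k × Fin k => E p.1 p.2)).comp hpair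
  have hfi : Integrable f μ := by
    refine (integrable_const (∑ p : Fin k × Fin k, |E p.1 p.2|)).mono hfm.aestronglyMeasurable
      (Eventually.of_forall fun x => ?_)
    refine le_trans ?_ (le_abs_self _)
    exact Finset.single_le_sum (f := fun p : Fin k × Fin k => |E p.1 p.2|)
      (fun p _ => abs_nonneg _) (Finset.mem_univ (θ (itinerary F lab j x), ζ x))
  obtain ⟨hi1, he1⟩ := integral_sum_iterate hinv hJi (n + j)
  obtain ⟨hi2, he2⟩ := integral_sum_iterate hinv hfi n
  have hi0 : Integrable (fun x => ψ (F^[n + j] x)) μ :=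
    (hinv.iterate (n + j)).integrable_comp_of_integrable hψ
  have he0 : ∫ x, ψ (F^[n + j] x) ∂μ = ∫ x, ψ x ∂μ := by
    conv_rhs => rw [← (hinv.iterate (n + j)).map_eq]
    rw [integral_map (hinv.iterate (n + j)).measurable.aemeasurable]
    rw [(hinv.iterate (n + j)).map_eq]
    exact hψ.aestronglyMeasurable
  set Φ : X → ℝ := fun x => ψ (F^[n + j] x) + ∑ i ∈ Finset.range (n + j), Real.log (J (F^[i] x))
    + ∑ i ∈ Finset.range n, f (F^[i] x) with hΦ
  have hi01 : Integrable (fun x => ψ (F^[n + j] x)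
      + ∑ i ∈ Finset.range (n + j), Real.log (J (F^[i] x))) μ := hi0.add hi1
  have hΦi : Integrable Φ μ := hi01.add hi2
  have hΦe : ∫ x, Φ x ∂μ = ∫ x, ψ x ∂μ + (n + j : ℕ) * ∫ x, Real.log (J x) ∂μ
      + n * ∫ x, f x ∂μ := by
    rw [hΦ, integral_add hi01 hi2, integral_add hi0 hi1, he0, he1, he2]
  -- The weight given to the itinerary `w` when the predictions are read off from the orbit of `y`.
  -- Its sum over `w` factors into `n` sums, each at most `1` by `hE`.
  set P : (Fin n → Fin k) → X → ℝ :=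
    fun w y => ∏ i : Fin n, Real.exp (-E (θ (itinerary F lab j (F^[i] y))) (w i)) with hP
  have hP0 : ∀ w y, 0 ≤ P w y := fun w y => Finset.prod_nonneg fun i _ => (Real.exp_pos _).le
  have hPsum : ∀ y, ∑ w, P w y ≤ 1 := by
    intro y
    have := Finset.prod_univ_sum (fun _ : Fin n => (Finset.univ : Finset (Fin k)))
      (fun i b => Real.exp (-E (θ (itinerary F lab j (F^[i] y))) b))
    rw [Fintype.piFinset_univ] at this
    rw [hP, ← this]
    exact Finset.prod_le_one (fun i _ => Finset.sum_nonneg fun b _ => (Real.exp_pos _).le)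
      fun i _ => hE _
  have hPm : ∀ w, Measurable (P w) := fun w => by
    refine Finset.measurable_prod _ fun i _ => ?_
    have h1 : Measurable fun y => θ (itinerary F lab j (F^[i] y)) := hθ.comp (hFm.iterate i)
    exact (Measurable.of_discrete (f := fun a => Real.exp (-E a (w i)))).comp h1
  have hPi : ∀ w, Integrable (P w) m := fun w => by
    refine (integrable_const (1 : ℝ)).mono (hPm w).aestronglyMeasurable
      (Eventually.of_forall fun y => ?_)
    rw [Real.norm_of_nonneg (hP0 w y), norm_one]
    exact (Finset.single_le_sum (f := fun w => P w y) (fun w _ => hP0 w y)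
      (Finset.mem_univ w)).trans (hPsum y)
  have hgibbs := sum_negMulLog_le (μ := μ) (ξ := itinerary F ζ n) (ρ := fun x => Real.exp (-Φ x))
    (ν := fun w => ∫ y, P w y ∂m) (measurable_itinerary hFm hζ n)
    (Eventually.of_forall fun x => Real.exp_pos _) (by simpa using hΦi)
    (fun w => integral_nonneg (hP0 w)) ?_
  · rw [refinementEntropy_eq_sum_itinerary]
    refine hgibbs.trans ?_
    simp only [Real.log_exp, neg_neg]
    rw [hΦe, ← integral_finsetSum _ fun w _ => hPi w]
    gcongr
    calc ∫ y, ∑ w, P w y ∂m ≤ ∫ y, 1 ∂m :=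
          integral_mono (integrable_finsetSum _ fun w _ => hPi w) (integrable_const _) hPsum
      _ = m.real univ := by simp
  · filter_upwards [hgood (n + j)] with x hx
    set C := itinerary F lab (n + j) ⁻¹' {itinerary F lab (n + j) x} with hC
    have hCm : MeasurableSet C := hIN (measurableSet_singleton _)
    -- The prediction at a time `i < n` reads the labels at times `i, …, i + j - 1`; this is why
    -- cylinders of length `n + j` are used.
    have hconst : ∀ y ∈ C, P (itinerary F ζ n x) y
        = Real.exp (-∑ i ∈ Finset.range n, f (F^[i] x)) := by
      intro y hy
      rw [← Finset.sum_neg_distrib, Real.exp_sum, Finset.prod_range]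
      refine Finset.prod_congr rfl fun i _ => ?_
      rw [itinerary_add_congr (show itinerary F lab (n + j) y = itinerary F lab (n + j) x from hy)
        i.2.le]
      rfl
    have h1 : m.real C * Real.exp (-∑ i ∈ Finset.range n, f (F^[i] x))
        ≤ ∫ y, P (itinerary F ζ n x) y ∂m := by
      calc _ = ∫ y in C, P (itinerary F ζ n x) y ∂m := by
            rw [setIntegral_congr_fun hCm hconst]
            simp
        _ ≤ _ := setIntegral_le_integral (hPi _) (Eventually.of_forall (hP0 _))
    refine le_trans ?_ h1
    have hJp : 0 < orbitProd F J (n + j) x := zero_lt_one.trans_le (hF.one_le_orbitProd hx)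
    have hlog : ∑ i ∈ Finset.range (n + j), Real.log (J (F^[i] x))
        = Real.log (orbitProd F J (n + j) x) := by
      rw [orbitProd, Real.log_prod]
      exact fun i hi => (zero_lt_one.trans_le
        (hF.one_le_jacobian _ (hx ⟨i, Finset.mem_range.1 hi⟩))).ne'
    simp only [hΦ]
    rw [neg_add, Real.exp_add]
    gcongr
    rw [hlog, neg_add, Real.exp_add, Real.exp_neg (Real.log _), Real.exp_log hJp,
      ← div_eq_mul_inv, div_le_iff₀ hJp, mul_comm (m.real C)]
    exact hcyl x hx

/-- The three errors `η` per unit of time are the rare visits outside `Q`, the cost of correct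
predictions and the cost of wrong ones. -/
theorem IsFullBranchMap.partitionEntropy_le [EMetricSpace X] [CompactSpace X] [BorelSpace X]
    [Countable ι] [DiscreteMeasurableSpace ι]
    (hF : IsFullBranchMap m F lab good J) [IsFiniteMeasure m] [IsProbabilityMeasure μ]
    (hac : μ ≪ m) (hinv : MeasurePreserving F μ μ)
    {κ K D : ℝ} (hκ0 : 0 < κ) (hκ1 : κ < 1) (hK : 0 ≤ K) (hD : ∀ x y : X, (edist x y).toReal ≤ D)
    (hdist : ∀ x y, lab x ∈ good → lab x = lab y →
      J y ≤ J x * (1 + K * (edist (F x) (F y)).toReal))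
    (hQ : ∀ ε > 0, ∃ Q, MeasurableSet Q ∧ μ.real Qᶜ ≤ ε ∧ ∃ L, 0 ≤ L ∧
      ContractsOn F lab good κ L Q)
    (hJi : Integrable (fun x => Real.log (J x)) μ) {k : ℕ} {ζ : X → Fin k} (hζ : Measurable ζ)
    {η : ℝ} (hη : 0 < η) :
    partitionEntropy μ F ζ ≤ ENNReal.ofReal (∫ x, Real.log (J x) ∂μ + 3 * η) := by
  have hne : Nonempty X := nonempty_of_isProbabilityMeasure μ
  have hk0 : (0 : ℝ) < k := by
    have := Fin.pos (ζ hne.some)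
    exact_mod_cast this
  have hk1 : (1 : ℝ) ≤ k := by
    have := Fin.pos (ζ hne.some)
    exact_mod_cast this
  have hD0 : 0 ≤ D := by simpa using hD hne.some hne.some
  have hgood : ∀ n, ∀ᵐ x ∂μ, ∀ i, itinerary F lab n x i ∈ good := fun n =>
    ae_all_iff.2 fun i =>
      (hinv.iterate i).quasiMeasurePreserving.ae (hac.ae_le hF.ae_good)
  have hI0 : 0 ≤ ∫ x, Real.log (J x) ∂μ := by
    refine integral_nonneg_of_ae ?_
    filter_upwards [hac.ae_le hF.ae_good] with x hx
    exact Real.log_nonneg (hF.one_le_jacobian x hx)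
  have hexp : Real.exp (-η) < 1 := by simpa using hη
  -- Chosen so that `exp (-η) + k * q = 1`: a correct prediction costs `η`, a wrong one costs `M =
  -- -log q`, and the Kraft inequality holds.
  set q := (1 - Real.exp (-η)) / k with hq
  have hq0 : 0 < q := div_pos (by linarith) hk0
  set M := -Real.log q with hM
  have hM0 : 0 ≤ M := by
    refine neg_nonneg.2 (Real.log_nonpos hq0.le ((div_le_one hk0).2 ?_))
    have := Real.exp_pos (-η)
    linarith
  set E : Fin k → Fin k → ℝ := fun a b => if a = b then η else M with hEdef
  have hE : ∀ a, ∑ b, Real.exp (-E a b) ≤ 1 := by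
    intro a
    calc ∑ b, Real.exp (-E a b) ≤ ∑ b, ((if a = b then Real.exp (-η) else 0) + q) := by
          refine Finset.sum_le_sum fun b _ => ?_
          by_cases hab : a = b
          · simp [hEdef, hab, hq0.le]
          · simp [hEdef, hab, hM, Real.exp_log hq0]
      _ = 1 := by
          rw [Finset.sum_add_distrib]
          simp only [Finset.sum_ite_eq, Finset.mem_univ, if_true, Finset.sum_const,
            Finset.card_univ, Fintype.card_fin, nsmul_eq_mul, hq]
          field_simp
          ring
  set c := Real.log (1 + K * D) with hc
  have hKD : 1 ≤ 1 + K * D := by linarith [mul_nonneg hK hD0]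
  have hc0 : 0 ≤ c := Real.log_nonneg hKD
  -- The second term makes `2 * M * ε` and `c * ε` at most `η`, the `+ 1` keeping its denominator
  -- positive; the bound `1 / 2` forces `μ Q > 0`, hence `m Q > 0`.
  set ε := min (1 / 2) (η / (2 * (2 * M) + c + 1)) with hε
  have hden : 0 < 2 * (2 * M) + c + 1 := by positivity
  have hε0 : 0 < ε := lt_min (by norm_num) (div_pos hη hden)
  have hεη : ε * (2 * (2 * M) + c + 1) ≤ η := (le_div_iff₀ hden).1 (min_le_right _ _)
  have hMε : M * (2 * ε) ≤ η := by nlinarith [mul_nonneg hε0.le hM0, mul_nonneg hε0.le hc0]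
  have hcε : c * ε ≤ η := by nlinarith [mul_nonneg hε0.le hM0, mul_nonneg hε0.le hc0]
  obtain ⟨Q, hQm, hQε, L, hL0, hL⟩ := hQ ε hε0
  obtain ⟨j, θ, hθ⟩ := exists_approx_label hinv hgood hκ0 hκ1 hε0 hQm hQε hL hζ
  have hmpos : ∀ S, MeasurableSet S → μ S ≠ 0 → 0 < m.real S := fun S _ hS =>
    ENNReal.toReal_pos (fun h => hS (hac h)) (measure_ne_top _ _)
  have hmX : 0 < m.real univ := hmpos _ MeasurableSet.univ (by simp)
  have hmQ : 0 < m.real Q := by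
    refine hmpos _ hQm fun h0 => ?_
    have h1 := probReal_compl_eq_one_sub (μ := μ) hQm
    rw [Measure.real, Measure.real, h0] at h1
    have h2 : μ.real Qᶜ = 1 := by
      rw [Measure.real]
      simpa using h1
    have : ε ≤ 1 / 2 := min_le_left _ _
    linarith
  set a := K * L * (1 - κ)⁻¹ - Real.log (m.real Q) with ha
  set b := -Real.log (m.real univ) with hb
  classical
  -- Minus the log of the constant in the cylinder bound: independent of `N` by bounded distortion
  -- if the endpoint is in `Q`, linear in `N` by the crude bound otherwise.
  set ψ : ℕ → X → ℝ := fun N z => if z ∈ Q then a else N * c + b with hψ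
  have hψm : ∀ N, Measurable (ψ N) := fun N => Measurable.ite hQm measurable_const measurable_const
  have hψi : ∀ N, Integrable (ψ N) μ := fun N => by
    refine (integrable_const (|a| + |N * c + b|)).mono (hψm N).aestronglyMeasurable
      (Eventually.of_forall fun x => ?_)
    refine le_trans ?_ (le_abs_self _)
    simp only [hψ, Real.norm_eq_abs]
    split_ifs
    · linarith [abs_nonneg (N * c + b)]
    · linarith [abs_nonneg a]
  have hψint : ∀ N : ℕ, ∫ x, ψ N x ∂μ ≤ |a| + |b| + N * η := by
    intro N
    calc ∫ x, ψ N x ∂μ ≤ ∫ x, (|a| + |b| + Qᶜ.indicator (fun _ => N * c) x) ∂μ := by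
          refine integral_mono (hψi N)
            ((integrable_const _).add ((integrable_const _).indicator hQm.compl)) fun x => ?_
          by_cases hx : x ∈ Q
          · simp only [hψ, hx, if_true, mem_compl_iff, not_true, not_false_iff, indicator_of_notMem]
            linarith [le_abs_self a, abs_nonneg b]
          · simp only [hψ, hx, if_false, mem_compl_iff, not_false_iff, indicator_of_mem]
            linarith [le_abs_self b, abs_nonneg a]
      _ = |a| + |b| + μ.real Qᶜ * (N * c) := by
          rw [integral_add (integrable_const _) ((integrable_const _).indicator hQm.compl),
            integral_indicator_const _ hQm.compl]
          simp
      _ ≤ |a| + |b| + N * η := by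
          have h1 : μ.real Qᶜ * (N * c) ≤ ε * (N * c) := by gcongr
          have h2 : N * (c * ε) ≤ N * η := by gcongr
          linarith
  have hcyl : ∀ (N : ℕ) x, (∀ i, itinerary F lab N x i ∈ good) → Real.exp (-ψ N (F^[N] x))
      ≤ orbitProd F J N x * m.real (itinerary F lab N ⁻¹' {itinerary F lab N x}) := by
    intro N x hx
    have hJp : 0 < orbitProd F J N x := zero_lt_one.trans_le (hF.one_le_orbitProd hx)
    by_cases hxQ : F^[N] x ∈ Q
    · have h1 := hF.measureReal_le_mul_cylinder hx hQm
        (c := Real.exp (K * L * (1 - κ)⁻¹) * orbitProd F J N x) (by positivity)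
        fun y hy hyQ => orbitProd_le_exp_mul hF.one_le_jacobian hκ0 hκ1 hL0 hK hdist hL hx
          hy.symm hxQ hyQ
      simp only [hψ, hxQ, if_true, ha, neg_sub]
      rw [Real.exp_sub, Real.exp_log hmQ, div_le_iff₀ (Real.exp_pos _)]
      linarith
    · have h1 := hF.measureReal_le_mul_cylinder hx MeasurableSet.univ
        (c := (1 + K * D) ^ N * orbitProd F J N x) (by positivity)
        fun y hy _ => orbitProd_le_pow_mul hF.one_le_jacobian hK hD hdist hx hy.symm
      simp only [hψ, hxQ, if_false, hb]
      rw [show -((N : ℝ) * c + -Real.log (m.real univ)) = Real.log (m.real univ) - N * c by ring,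
        Real.exp_sub, Real.exp_log hmX, Real.exp_nat_mul, hc, Real.exp_log (by positivity),
        div_le_iff₀ (by positivity)]
      linarith
  have hEint : ∫ x, E (θ (itinerary F lab j x)) (ζ x) ∂μ ≤ 2 * η := by
    have hθm : Measurable fun x => θ (itinerary F lab j x) :=
      (Measurable.of_discrete (f := θ)).comp
        (measurable_itinerary hF.measurable_map hF.measurable_label j)
    have hSm : MeasurableSet {x | θ (itinerary F lab j x) ≠ ζ x} :=
      (measurableSet_eq_fun hθm hζ).compl
    set S := {x | θ (itinerary F lab j x) ≠ ζ x}
    calc ∫ x, E (θ (itinerary F lab j x)) (ζ x) ∂μ ≤ ∫ x, (η + S.indicator (fun _ => M) x) ∂μ := by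
          refine integral_mono_of_nonneg (Eventually.of_forall fun x => ?_)
            ((integrable_const _).add ((integrable_const _).indicator hSm))
            (Eventually.of_forall fun x => ?_)
          · simp only [hEdef, Pi.zero_apply]
            split_ifs
            exacts [hη.le, hM0]
          · by_cases hx : θ (itinerary F lab j x) = ζ x
            · have : x ∉ S := not_not.2 hx
              simp [hEdef, hx, this]
            · have : x ∈ S := hx
              simp [hEdef, hx, this, hη.le]
      _ = η + μ.real S * M := by
          rw [integral_add (integrable_const _) ((integrable_const _).indicator hSm),
            integral_indicator_const _ hSm]
          simp
      _ ≤ 2 * η := by nlinarith [mul_le_mul_of_nonneg_right hθ hM0]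
  set I := ∫ x, Real.log (J x) ∂μ with hI
  set B := |a| + |b| + j * (I + η) + m.real univ with hB
  have hH : ∀ n : ℕ, refinementEntropy μ F ζ n ≤ n * (I + 3 * η) + B := by
    intro n
    have h1 := hF.refinementEntropy_le hinv hgood hJi hζ hE θ (hψi (n + j)) (hcyl (n + j))
    have h2 := hψint (n + j)
    have h3 : (n : ℝ) * ∫ x, E (θ (itinerary F lab j x)) (ζ x) ∂μ ≤ n * (2 * η) := by gcongr
    push_cast at h1 h2
    rw [hB]
    linarith
  have hlim : Tendsto (fun n : ℕ => ENNReal.ofReal (I + 3 * η + B / n)) atTop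
      (𝓝 (ENNReal.ofReal (I + 3 * η))) := by
    refine (ENNReal.continuous_ofReal.tendsto _).comp ?_
    simpa using (tendsto_const_div_atTop_nhds_zero_nat B).const_add (I + 3 * η)
  rw [← hlim.limsup_eq]
  refine limsup_le_limsup ?_
  filter_upwards [eventually_gt_atTop 0] with n hn
  refine ENNReal.ofReal_le_ofReal ?_
  have hn' : (0 : ℝ) < n := by exact_mod_cast hn
  rw [div_le_iff₀ hn']
  refine (hH n).trans (le_of_eq ?_)
  field_simp

/-- Rokhlin's formula for countable full-branch maps with bounded distortion. -/
theorem IsFullBranchMap.metricEntropy_eq [EMetricSpace X] [CompactSpace X] [BorelSpace X]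
    [Countable ι] [DiscreteMeasurableSpace ι]
    (hF : IsFullBranchMap m F lab good J) [IsFiniteMeasure m] [IsProbabilityMeasure μ]
    (hac : μ ≪ m) (hinv : MeasurePreserving F μ μ)
    {κ K D : ℝ} (hκ0 : 0 < κ) (hκ1 : κ < 1) (hK : 0 ≤ K) (hD : ∀ x y : X, (edist x y).toReal ≤ D)
    (hdist : ∀ x y, lab x ∈ good → lab x = lab y →
      J y ≤ J x * (1 + K * (edist (F x) (F y)).toReal))
    (hQ : ∀ ε > 0, ∃ Q, MeasurableSet Q ∧ μ.real Qᶜ ≤ ε ∧ ∃ L, 0 ≤ L ∧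
      ContractsOn F lab good κ L Q) :
    metricEntropy μ F = ∫⁻ x, ENNReal.ofReal (Real.log (J x)) ∂μ := by
  refine le_antisymm ?_ (hF.lintegral_log_jacobian_le_metricEntropy hac hinv)
  have hpos : ∀ᵐ x ∂μ, 0 ≤ Real.log (J x) := by
    filter_upwards [hac.ae_le hF.ae_good] with x hx
    exact Real.log_nonneg (hF.one_le_jacobian x hx)
  by_cases hfin : ∫⁻ x, ENNReal.ofReal (Real.log (J x)) ∂μ = ⊤
  · simp [hfin]
  have hJi : Integrable (fun x => Real.log (J x)) μ := by
    refine ⟨(Real.measurable_log.comp hF.measurable_jacobian).aestronglyMeasurable, ?_⟩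
    rw [hasFiniteIntegral_iff_ofReal hpos]
    exact lt_top_iff_ne_top.2 hfin
  refine iSup_le fun k => iSup_le fun ζ => iSup_le fun hζ => ?_
  rw [← ofReal_integral_eq_lintegral_ofReal hJi hpos]
  refine ENNReal.le_of_forall_pos_le_add fun ε hε _ => ?_
  refine (hF.partitionEntropy_le hac hinv hκ0 hκ1 hK hD hdist hQ hJi hζ
    (η := ε / 3) (by positivity)).trans (le_of_eq ?_)
  rw [ENNReal.ofReal_add (integral_nonneg_of_ae hpos) (by positivity)]
  congr 1
  rw [mul_div_cancel₀ _ (by norm_num : (3 : ℝ) ≠ 0), ENNReal.ofReal_coe_nnreal]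

end UpperBound

/-! ### Contraction of inverse branches along paths -/

section Paths

theorem ContinuousLinearMap.inverse_eq_of_comp_eq_id {E : Type*} [NormedAddCommGroup E]
    [NormedSpace ℝ E] [FiniteDimensional ℝ E] {A B : E →L[ℝ] E}
    (h : A ∘L B = ContinuousLinearMap.id ℝ E) : A.inverse = B := by
  have h1 : (A.toLinearMap : Module.End ℝ E) * B.toLinearMap = 1 :=
    congrArg ContinuousLinearMap.toLinearMap h
  exact ContinuousLinearMap.inverse_eq h
    (ContinuousLinearMap.coe_injective (mul_eq_one_comm.1 h1))

/-- Written on the model space: `F (Φ.symm y)` equals `y` only propositionally, so the two tangent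
spaces are not syntactically the same. -/
theorem PartialDiffeomorph.mfderiv_comp_mfderiv_symm {d : ℕ} {M : Type*}
    [TopologicalSpace M] [ChartedSpace (EuclideanSpace ℝ (Fin d)) M]
    (Φ : PartialDiffeomorph (𝓡 d) (𝓡 d) M M 2)
    {F : M → M} (hF : EqOn F Φ Φ.source) {y : M} (hy : y ∈ Φ.target) :
    (mfderiv (𝓡 d) (𝓡 d) F (Φ.symm y) :
        EuclideanSpace ℝ (Fin d) →L[ℝ] EuclideanSpace ℝ (Fin d)) ∘L
      (mfderiv (𝓡 d) (𝓡 d) Φ.symm y : EuclideanSpace ℝ (Fin d) →L[ℝ] EuclideanSpace ℝ (Fin d))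
        = ContinuousLinearMap.id ℝ (EuclideanSpace ℝ (Fin d)) := by
  have hx : Φ.symm y ∈ Φ.source := Φ.map_target hy
  have hFe : F =ᶠ[𝓝 (Φ.symm y)] Φ := hF.eventuallyEq_of_mem (Φ.open_source.mem_nhds hx)
  have h1 : MDifferentiableAt (𝓡 d) (𝓡 d) F (Φ.symm y) :=
    (Φ.mdifferentiableAt two_ne_zero hx).congr_of_eventuallyEq hFe
  have h2 : MDifferentiableAt (𝓡 d) (𝓡 d) Φ.symm y := Φ.symm.mdifferentiableAt two_ne_zero hy
  have h3 : F ∘ Φ.symm =ᶠ[𝓝 y] id := by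
    filter_upwards [Φ.open_target.mem_nhds hy] with z hz
    have : F (Φ.symm z) = Φ (Φ.symm z) := hF (Φ.map_target hz)
    simp only [Function.comp_apply, id, this]
    exact Φ.right_inv hz
  have h4 := mfderiv_comp y h1 h2
  rw [h3.mfderiv_eq, mfderiv_id] at h4
  exact h4.symm

variable {d : ℕ} {M : Type*} [EMetricSpace M]
  [ChartedSpace (EuclideanSpace ℝ (Fin d)) M]
  [RiemannianBundle (fun x : M => TangentSpace (𝓡 d) x)]

/-- Two points are joined by a chain of `C¹` paths inside `S`, of total length `ℓ`. -/
inductive ChainJoined (d : ℕ) {M : Type*} [EMetricSpace M]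
    [ChartedSpace (EuclideanSpace ℝ (Fin d)) M]
    [RiemannianBundle (fun x : M => TangentSpace (𝓡 d) x)] (S : Set M) : ℝ≥0∞ → M → M → Prop
  | path (γ : ℝ → M) (hγ : ContMDiffOn 𝓘(ℝ, ℝ) (𝓡 d) 1 γ (Icc 0 1))
      (hS : ∀ t ∈ Icc (0 : ℝ) 1, γ t ∈ S) : ChainJoined d S (pathELength (𝓡 d) γ 0 1) (γ 0) (γ 1)
  | trans {a b : ℝ≥0∞} {x y z : M} : ChainJoined d S a x y → ChainJoined d S b y z →
      ChainJoined d S (a + b) x z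

theorem ChainJoined.edist_le [IsRiemannianManifold (𝓡 d) M] {S : Set M} {ℓ : ℝ≥0∞} {x y : M}
    (h : ChainJoined d S ℓ x y) : edist x y ≤ ℓ := by
  induction h with
  | path γ hγ hS =>
    rw [IsRiemannianManifold.out (I := 𝓡 d)]
    exact riemannianEDist_le_pathELength hγ rfl rfl zero_le_one
  | trans _ _ h1 h2 => exact (edist_triangle _ _ _).trans (add_le_add h1 h2)

/-- A path from `x` of length less than `r` cannot leave the ball of radius `r`, since its initial
segments are shorter still. -/
theorem exists_chainJoined_of_edist_lt [IsRiemannianManifold (𝓡 d) M] {x y : M} {r : ℝ≥0∞}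
    {S : Set M} (h : edist x y < r) (hS : ∀ z, edist x z < r → z ∈ S) :
    ∃ ℓ ≤ r, ChainJoined d S ℓ x y := by
  rw [IsRiemannianManifold.out (I := 𝓡 d)] at h
  obtain ⟨γ, h0, h1, hγ, hl⟩ := exists_lt_of_riemannianEDist_lt h
  subst h0 h1
  refine ⟨_, hl.le, ChainJoined.path γ hγ fun t ht => hS _ ?_⟩
  rw [IsRiemannianManifold.out (I := 𝓡 d)]
  refine (riemannianEDist_le_pathELength (hγ.mono (Icc_subset_Icc_right ht.2)) rfl rfl
    ht.1).trans_lt ((pathELength_mono le_rfl ht.2).trans_lt hl)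

/-- Both directions are recorded, so that paths need never be reversed. Halving the radius keeps the
path from `y` back to `x`, controlled around `y`, inside `S`. -/
theorem exists_ball_chainJoined [IsRiemannianManifold (𝓡 d) M] {S : Set M} (hS : IsOpen S) {x : M}
    (hx : x ∈ S) : ∀ᶠ y in 𝓝 x,
      (∃ ℓ ≤ 1, ChainJoined d S ℓ x y) ∧ ∃ ℓ ≤ 1, ChainJoined d S ℓ y x := by
  obtain ⟨r, hr, hsub⟩ := EMetric.isOpen_iff.1 hS x hx
  have hr2 : 0 < min 1 (r / 2) := lt_min one_pos (ENNReal.half_pos hr.ne')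
  filter_upwards [Metric.eball_mem_nhds x hr2] with y hy
  have hxy : edist x y < min 1 (r / 2) := by rw [edist_comm]; exact hy
  obtain ⟨ℓ, hℓ, h1⟩ := exists_chainJoined_of_edist_lt (d := d) hxy (S := S) fun z hz => hsub (by
    rw [Metric.mem_eball, edist_comm]
    exact hz.trans_le ((min_le_right _ _).trans ENNReal.half_le_self))
  obtain ⟨ℓ', hℓ', h2⟩ := exists_chainJoined_of_edist_lt (d := d) (x := y) (y := x) hy (S := S)
    fun z hz => hsub (by
      rw [Metric.mem_eball, edist_comm]
      calc edist x z ≤ edist x y + edist y z := edist_triangle _ _ _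
        _ < r / 2 + r / 2 :=
          ENNReal.add_lt_add (hxy.trans_le (min_le_right _ _)) (hz.trans_le (min_le_right _ _))
        _ = r := ENNReal.add_halves r)
  exact ⟨⟨ℓ, hℓ.trans (min_le_left _ _), h1⟩, ⟨ℓ', hℓ'.trans (min_le_left _ _), h2⟩⟩

/-- Compact subsets of a connected open set have finite intrinsic diameter. -/
theorem exists_forall_chainJoined_of_isCompact [IsRiemannianManifold (𝓡 d) M] {S Q : Set M}
    (hS : IsOpen S) (hSc : IsPreconnected S) (hQ : IsCompact Q) (hQS : Q ⊆ S) :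
    ∃ L : ℝ≥0∞, L ≠ ⊤ ∧ ∀ x ∈ Q, ∀ y ∈ Q, ∃ ℓ ≤ L, ChainJoined d S ℓ x y := by
  rcases Q.eq_empty_or_nonempty with rfl | ⟨z, hz⟩
  · exact ⟨0, by simp, by simp⟩
  have hjoin : ∀ x ∈ S, ∀ y ∈ S, ∃ ℓ : ℝ≥0∞, ℓ ≠ ⊤ ∧ ChainJoined d S ℓ x y := by
    intro x hx y hy
    refine hSc.induction₂' (fun x y => ∃ ℓ : ℝ≥0∞, ℓ ≠ ⊤ ∧ ChainJoined d S ℓ x y) ?_ ?_ hx hy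
    · intro x hx
      filter_upwards [nhdsWithin_le_nhds (exists_ball_chainJoined (d := d) hS hx)]
      rintro y ⟨⟨ℓ, hℓ, h⟩, ℓ', hℓ', h'⟩
      exact ⟨⟨ℓ, ne_top_of_le_ne_top (by simp) hℓ, h⟩, ℓ', ne_top_of_le_ne_top (by simp) hℓ', h'⟩
    · rintro x y z - - - ⟨ℓ, hℓ, h⟩ ⟨ℓ', hℓ', h'⟩
      exact ⟨ℓ + ℓ', by simp [hℓ, hℓ'], h.trans h'⟩
  -- Connectedness gave finite but non-uniform lengths; compactness makes them uniform, since near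
  -- `x` a chain to `x` extends at extra cost at most `1`. All pairs are then joined through the
  -- base point `z`.
  have key : ∃ L : ℝ≥0∞, L ≠ ⊤ ∧ ∀ y ∈ Q, (∃ ℓ ≤ L, ChainJoined d S ℓ z y) ∧
      ∃ ℓ ≤ L, ChainJoined d S ℓ y z := by
    refine hQ.induction_on (p := fun A => ∃ L : ℝ≥0∞, L ≠ ⊤ ∧ ∀ y ∈ A,
      (∃ ℓ ≤ L, ChainJoined d S ℓ z y) ∧ ∃ ℓ ≤ L, ChainJoined d S ℓ y z) ?_ ?_ ?_ ?_
    · exact ⟨0, by simp, by simp⟩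
    · rintro A B hAB ⟨L, hL, h⟩
      exact ⟨L, hL, fun y hy => h y (hAB hy)⟩
    · rintro A B ⟨L, hL, h⟩ ⟨L', hL', h'⟩
      refine ⟨max L L', by simp [hL, hL'], ?_⟩
      rintro y (hy | hy)
      · obtain ⟨⟨a, ha, h1⟩, b, hb, h2⟩ := h y hy
        exact ⟨⟨a, ha.trans (le_max_left _ _), h1⟩, b, hb.trans (le_max_left _ _), h2⟩
      · obtain ⟨⟨a, ha, h1⟩, b, hb, h2⟩ := h' y hy
        exact ⟨⟨a, ha.trans (le_max_right _ _), h1⟩, b, hb.trans (le_max_right _ _), h2⟩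
    · intro x hx
      obtain ⟨a, ha, h1⟩ := hjoin z (hQS hz) x (hQS hx)
      obtain ⟨b, hb, h2⟩ := hjoin x (hQS hx) z (hQS hz)
      refine ⟨_, nhdsWithin_le_nhds (exists_ball_chainJoined (d := d) hS (hQS hx)), max a b + 1,
        by simp [ha, hb], ?_⟩
      rintro y ⟨⟨ℓ, hℓ, h⟩, ℓ', hℓ', h'⟩
      refine ⟨⟨a + ℓ, add_le_add (le_max_left _ _) hℓ, h1.trans h⟩, ℓ' + b, ?_, h'.trans h2⟩
      rw [add_comm]
      exact add_le_add (le_max_right _ _) hℓ'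
  obtain ⟨L, hL, h⟩ := key
  refine ⟨L + L, by simp [hL], fun x hx y hy => ?_⟩
  obtain ⟨-, a, ha, h1⟩ := h x hx
  obtain ⟨⟨b, hb, h2⟩, -⟩ := h y hy
  exact ⟨a + b, add_le_add ha hb, h1.trans h2⟩

theorem pathELength_comp_le {S : Set M} (hS : IsOpen S) {g : M → M}
    (hg : ContMDiffOn (𝓡 d) (𝓡 d) 1 g S) {κ : ℝ≥0∞} (hκ : κ ≠ ⊤)
    (hgκ : ∀ x ∈ S, ‖mfderiv (𝓡 d) (𝓡 d) g x‖ₑ ≤ κ) {γ : ℝ → M}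
    (hγ : ContMDiffOn 𝓘(ℝ, ℝ) (𝓡 d) 1 γ (Icc 0 1)) (hγS : ∀ t ∈ Icc (0 : ℝ) 1, γ t ∈ S) :
    pathELength (𝓡 d) (g ∘ γ) 0 1 ≤ κ * pathELength (𝓡 d) γ 0 1 := by
  rw [pathELength_eq_lintegral_mfderiv_Ioo, pathELength_eq_lintegral_mfderiv_Ioo,
    ← lintegral_const_mul' _ _ hκ]
  refine setLIntegral_mono' measurableSet_Ioo fun t ht => ?_
  have hmem := hγS t ⟨ht.1.le, ht.2.le⟩
  have hγt : MDifferentiableAt 𝓘(ℝ, ℝ) (𝓡 d) γ t :=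
    ((hγ t ⟨ht.1.le, ht.2.le⟩).contMDiffAt (Icc_mem_nhds ht.1 ht.2)).mdifferentiableAt one_ne_zero
  have hgt : MDifferentiableAt (𝓡 d) (𝓡 d) g (γ t) :=
    ((hg _ hmem).contMDiffAt (hS.mem_nhds hmem)).mdifferentiableAt one_ne_zero
  have h1 : mfderiv 𝓘(ℝ, ℝ) (𝓡 d) (g ∘ γ) t 1
      = mfderiv (𝓡 d) (𝓡 d) g (γ t) (mfderiv 𝓘(ℝ, ℝ) (𝓡 d) γ t 1) :=
    congr($(mfderiv_comp t hgt hγt) 1)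
  rw [h1]
  refine (ContinuousLinearMap.le_opENorm _ _).trans ?_
  gcongr
  exact hgκ _ hmem

theorem ChainJoined.image {S T : Set M} (hS : IsOpen S) {g : M → M}
    (hg : ContMDiffOn (𝓡 d) (𝓡 d) 1 g S) (hST : MapsTo g S T) {κ : ℝ≥0∞} (hκ : κ ≠ ⊤)
    (hgκ : ∀ x ∈ S, ‖mfderiv (𝓡 d) (𝓡 d) g x‖ₑ ≤ κ) {ℓ : ℝ≥0∞} {x y : M}
    (h : ChainJoined d S ℓ x y) : ∃ ℓ' ≤ κ * ℓ, ChainJoined d T ℓ' (g x) (g y) := by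
  induction h with
  | path γ hγ hγS =>
    exact ⟨_, pathELength_comp_le hS hg hκ hgκ hγ hγS,
      ChainJoined.path (g ∘ γ) (hg.comp hγ hγS) fun t ht => hST (hγS t ht)⟩
  | trans _ _ h1 h2 =>
    obtain ⟨a, ha, h1⟩ := h1
    obtain ⟨b, hb, h2⟩ := h2
    exact ⟨a + b, by rw [mul_add]; exact add_le_add ha hb, h1.trans h2⟩

/-- The norm depends on the base point through the Riemannian metric, so it must be transported
along an equality of base points. -/
theorem norm_tangentSpace_hom_congr {a a' b : M} (h : a = a')
    (A : EuclideanSpace ℝ (Fin d) →L[ℝ] EuclideanSpace ℝ (Fin d)) :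
    ‖(show TangentSpace (𝓡 d) a →L[ℝ] TangentSpace (𝓡 d) b from A)‖
      = ‖(show TangentSpace (𝓡 d) a' →L[ℝ] TangentSpace (𝓡 d) b from A)‖ := by
  subst h
  rfl

/-- By the chain rule the derivative of the inverse branch at `y` is the inverse of `DF` at `Φ.symm
y`, to which the expansion hypothesis applies. -/
theorem PartialDiffeomorph.norm_mfderiv_symm_lt (Φ : PartialDiffeomorph (𝓡 d) (𝓡 d) M M 2)
    {F : M → M} (hF : EqOn F Φ Φ.source) {κ : ℝ}
    (hκ : ∀ x ∈ Φ.source, ‖(mfderiv (𝓡 d) (𝓡 d) F x).inverse‖ < κ) {y : M} (hy : y ∈ Φ.target) :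
    ‖mfderiv (𝓡 d) (𝓡 d) Φ.symm y‖ < κ := by
  have hx : Φ.symm y ∈ Φ.source := Φ.map_target hy
  have hFy : F (Φ.symm y) = y := (hF hx).trans (Φ.right_inv hy)
  have h1 := Φ.mfderiv_comp_mfderiv_symm hF hy
  have h4 : (mfderiv (𝓡 d) (𝓡 d) F (Φ.symm y) :
      EuclideanSpace ℝ (Fin d) →L[ℝ] EuclideanSpace ℝ (Fin d)).inverse
        = mfderiv (𝓡 d) (𝓡 d) Φ.symm y :=
    ContinuousLinearMap.inverse_eq_of_comp_eq_id h1
  have h5 := hκ _ hx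
  have h6 := norm_tangentSpace_hom_congr (d := d) (b := Φ.symm y) hFy
    (mfderiv (𝓡 d) (𝓡 d) Φ.symm y)
  rw [← h4] at h6
  refine lt_of_eq_of_lt ?_ h5
  refine Eq.trans ?_ h6.symm
  rw [h4]

/-- The branches of a piecewise expanding Markov map contract on compact subsets of the disk. -/
theorem contractsOn_of_isCompact [IsRiemannianManifold (𝓡 d) M] {ι : Type*} {F : M → M}
    {lab : M → ι} {good : Set ι} {S : Set M} (hS : IsOpen S) (hSc : IsPreconnected S)
    (hsub : ∀ i ∈ good, lab ⁻¹' {i} ⊆ S)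
    (hmarkov : ∀ i ∈ good, ∃ Φ : PartialDiffeomorph (𝓡 d) (𝓡 d) M M 2,
      Φ.source = lab ⁻¹' {i} ∧ Φ.target = S ∧ EqOn F Φ (lab ⁻¹' {i}))
    {κ : ℝ} (hκ0 : 0 < κ) (hκ : ∀ i ∈ good, ∀ x ∈ lab ⁻¹' {i},
      ‖(mfderiv (𝓡 d) (𝓡 d) F x).inverse‖ < κ) {Q : Set M} (hQ : IsCompact Q) (hQS : Q ⊆ S) :
    ∃ L, 0 ≤ L ∧ ContractsOn F lab good κ L Q := by
  obtain ⟨L, hL, hjoin⟩ := exists_forall_chainJoined_of_isCompact (d := d) hS hSc hQ hQS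
  refine ⟨L.toReal, ENNReal.toReal_nonneg, fun n x y hx hxy hxQ hyQ => ?_⟩
  -- Backward induction from time `n`: each inverse branch along the common itinerary shortens the
  -- chain by `κ` and maps `S` into a branch domain contained in `S`, so it can be iterated.
  have key : ∀ l ≤ n, ∃ ℓ ≤ ENNReal.ofReal (κ ^ l) * L,
      ChainJoined d S ℓ (F^[n - l] x) (F^[n - l] y) := by
    intro l
    induction l with
    | zero => simpa using fun _ : 0 ≤ n => hjoin _ hxQ _ hyQ
    | succ l ih =>
      intro hl
      obtain ⟨ℓ, hℓ, h⟩ := ih (by omega)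
      have hlt : n - (l + 1) < n := by omega
      set i := n - (l + 1) with hi
      rw [show n - l = i + 1 by omega, Function.iterate_succ_apply',
        Function.iterate_succ_apply'] at h
      have hg : lab (F^[i] x) ∈ good := hx ⟨i, hlt⟩
      have heq : lab (F^[i] x) = lab (F^[i] y) := congrFun hxy ⟨i, hlt⟩
      obtain ⟨Φ, hΦs, hΦt, hΦ⟩ := hmarkov _ hg
      have hcontr : ∀ z ∈ S, ‖mfderiv (𝓡 d) (𝓡 d) Φ.symm z‖ₑ ≤ ENNReal.ofReal κ := by
        intro z hz
        rw [← ofReal_norm]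
        exact ENNReal.ofReal_le_ofReal (Φ.norm_mfderiv_symm_lt (hΦs ▸ hΦ)
          (hΦs ▸ hκ _ hg) (hΦt ▸ hz)).le
      have hsymm : ∀ z ∈ lab ⁻¹' {lab (F^[i] x)}, Φ.symm (F z) = z := fun z hz => by
        rw [hΦ hz]
        exact Φ.left_inv (hΦs ▸ hz)
      have hmaps : MapsTo Φ.symm S S := fun z hz =>
        hsub _ hg (hΦs ▸ Φ.map_target (hΦt ▸ hz))
      obtain ⟨ℓ', hℓ', h'⟩ := h.image hS
        ((Φ.contMDiffOn_invFun.of_le one_le_two).mono hΦt.ge) hmaps ENNReal.ofReal_ne_top hcontr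
      refine ⟨ℓ', hℓ'.trans ?_, ?_⟩
      · rw [pow_succ', ENNReal.ofReal_mul hκ0.le, mul_assoc]
        gcongr
      · have e1 := hsymm (F^[i] x) rfl
        have e2 := hsymm (F^[i] y) heq.symm
        change ChainJoined d S ℓ' (Φ.symm (F (F^[i] x))) (Φ.symm (F (F^[i] y))) at h'
        rwa [e1, e2] at h'
  intro i hi
  obtain ⟨ℓ, hℓ, h⟩ := key (n - i) (by omega)
  rw [show n - (n - i) = i by omega] at h
  refine (h.edist_le.trans hℓ).trans (le_of_eq ?_)
  rw [ENNReal.ofReal_mul (by positivity), ENNReal.ofReal_toReal hL]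

end Paths

/-! ### Jacobians and Riemannian volume -/

section Volume

theorem absDet_eq_normDet {V W : Type*} [NormedAddCommGroup V] [InnerProductSpace ℝ V]
    [FiniteDimensional ℝ V] [NormedAddCommGroup W] [InnerProductSpace ℝ W] [FiniteDimensional ℝ W]
    (A : V →ₗ[ℝ] W) : absDet A = A.normDet := by
  have h : A.normDet ^ 2 = LinearMap.det (LinearMap.adjoint A ∘ₗ A) := by
    exact_mod_cast A.normDet_sq
  rw [absDet, ← h, Real.sqrt_sq A.normDet_nonneg]

/-- `normDet` is the product of the singular values, each of which is at most `1` for a contraction.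
-/
theorem LinearMap.normDet_le_one {V W : Type*} [NormedAddCommGroup V] [InnerProductSpace ℝ V]
    [FiniteDimensional ℝ V] [NormedAddCommGroup W] [InnerProductSpace ℝ W] [FiniteDimensional ℝ W]
    {A : V →ₗ[ℝ] W} (hA : ∀ v, ‖A v‖ ≤ ‖v‖) : A.normDet ≤ 1 := by
  rw [A.normDet_eq_prod_singularValues]
  refine Finset.prod_le_one (fun i _ => A.singularValues_nonneg i) fun i hi => ?_
  obtain ⟨v, hv⟩ := (A.hasEigenvalue_adjoint_comp_self_sq_singularValues
    (Finset.mem_range.1 hi)).exists_hasEigenvector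
  have h1 : inner ℝ (A v) (A v) = (A.singularValues i) ^ 2 * inner ℝ v v := by
    rw [← LinearMap.adjoint_inner_left, ← LinearMap.comp_apply, hv.apply_eq_smul, inner_smul_left]
    simp
  rw [real_inner_self_eq_norm_sq, real_inner_self_eq_norm_sq] at h1
  have h2 : 0 < ‖v‖ := norm_pos_iff.2 hv.2
  have h3 : ‖A v‖ ^ 2 ≤ ‖v‖ ^ 2 := by gcongr; exact hA v
  have h4 : (A.singularValues i) ^ 2 ≤ 1 := by
    rw [h1] at h3
    have : 0 < ‖v‖ ^ 2 := by positivity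
    nlinarith
  exact (sq_le_one_iff₀ (A.singularValues_nonneg i)).1 h4

variable {d : ℕ} {M : Type*} [TopologicalSpace M] [ChartedSpace (EuclideanSpace ℝ (Fin d)) M]
  [RiemannianBundle (fun x : M => TangentSpace (𝓡 d) x)]

/-- The factor by which a map from Euclidean space to a Riemannian manifold scales volume. -/
def volumeScaling (g : EuclideanSpace ℝ (Fin d) → M) (y : EuclideanSpace ℝ (Fin d)) : ℝ :=
  LinearMap.normDet (U := EuclideanSpace ℝ (Fin d)) (V := TangentSpace (𝓡 d) (g y))
    (mfderiv (𝓡 d) (𝓡 d) g y).toLinearMap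

theorem volumeScaling_eq_sqrt_det (g : EuclideanSpace ℝ (Fin d) → M)
    (y : EuclideanSpace ℝ (Fin d)) : volumeScaling g y =
      Real.sqrt (Matrix.det (Matrix.of fun i j : Fin d =>
        inner ℝ (mfderiv (𝓡 d) (𝓡 d) g y (EuclideanSpace.single i (1 : ℝ) : EuclideanSpace ℝ (Fin d)))
          (mfderiv (𝓡 d) (𝓡 d) g y
            (EuclideanSpace.single j (1 : ℝ) : EuclideanSpace ℝ (Fin d))))) := by
  have h := LinearMap.normDet_sq_eq_det_gram (𝕜 := ℝ) (U := EuclideanSpace ℝ (Fin d))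
    (V := TangentSpace (𝓡 d) (g y)) (mfderiv (𝓡 d) (𝓡 d) g y).toLinearMap
    (EuclideanSpace.basisFun (Fin d) ℝ)
  have h0 : 0 ≤ volumeScaling g y := LinearMap.normDet_nonneg (U := EuclideanSpace ℝ (Fin d))
    (V := TangentSpace (𝓡 d) (g y)) _
  refine (Real.sqrt_sq h0).symm.trans ?_
  congr 1
  refine Eq.trans (by exact_mod_cast h) ?_
  congr 1
  ext i j
  simp only [Matrix.gram, Matrix.of_apply, EuclideanSpace.basisFun_apply]
  rfl

theorem volumeDensity_eq_volumeScaling (p : M) (y : EuclideanSpace ℝ (Fin d)) :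
    volumeDensity d p y = volumeScaling (chartAt (EuclideanSpace ℝ (Fin d)) p).symm y :=
  (volumeScaling_eq_sqrt_det _ y).symm

/-- The squared scaling is the Gram determinant of the images of the standard basis vectors, which
vary continuously in the tangent bundle. -/
theorem continuousOn_volumeScaling [IsManifold (𝓡 d) 1 M]
    [IsContinuousRiemannianBundle (EuclideanSpace ℝ (Fin d))
      (fun x : M => TangentSpace (𝓡 d) x)] {g : EuclideanSpace ℝ (Fin d) → M}
    {O : Set (EuclideanSpace ℝ (Fin d))} (hO : IsOpen O) (hg : ContMDiffOn (𝓡 d) (𝓡 d) 1 g O) :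
    ContinuousOn (volumeScaling g) O := by
  have hv : ∀ i : Fin d, ContinuousOn (fun y => (⟨g y, mfderiv (𝓡 d) (𝓡 d) g y
      (EuclideanSpace.single i (1 : ℝ) : EuclideanSpace ℝ (Fin d))⟩ :
        TotalSpace (EuclideanSpace ℝ (Fin d)) (fun x : M => TangentSpace (𝓡 d) x))) O := by
    intro i
    have h1 := hg.continuousOn_tangentMapWithin le_rfl hO.uniqueMDiffOn
    have h2 : ContinuousOn (fun y : EuclideanSpace ℝ (Fin d) =>
        (⟨y, (EuclideanSpace.single i (1 : ℝ) : EuclideanSpace ℝ (Fin d))⟩ :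
          TangentBundle (𝓡 d) (EuclideanSpace ℝ (Fin d)))) O :=
      ((tangentBundleModelSpaceHomeomorph (𝓡 d)).symm.continuous.comp
        (continuous_id.prodMk continuous_const)).continuousOn
    refine (h1.comp h2 fun y hy => hy).congr fun y hy => ?_
    simp only [Function.comp_apply, tangentMapWithin, mfderivWithin_of_isOpen hO hy]
  simp only [funext (volumeScaling_eq_sqrt_det g)]
  refine Real.continuous_sqrt.comp_continuousOn
    ((continuous_id.matrix_det).comp_continuousOn ?_)
  exact continuousOn_pi.2 fun i => continuousOn_pi.2 fun j => (hv i).inner_bundle (hv j)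

theorem normDet_tangentSpace_congr {a b : M} (h : a = b)
    (A : EuclideanSpace ℝ (Fin d) →ₗ[ℝ] EuclideanSpace ℝ (Fin d)) :
    LinearMap.normDet (U := EuclideanSpace ℝ (Fin d)) (V := TangentSpace (𝓡 d) a) A
      = LinearMap.normDet (U := EuclideanSpace ℝ (Fin d)) (V := TangentSpace (𝓡 d) b) A := by
  subst h
  rfl

theorem volumeScaling_comp {f : EuclideanSpace ℝ (Fin d) → EuclideanSpace ℝ (Fin d)}
    {g h : EuclideanSpace ℝ (Fin d) → M} {y : EuclideanSpace ℝ (Fin d)}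
    (hf : DifferentiableAt ℝ f y) (hg : MDifferentiableAt (𝓡 d) (𝓡 d) g (f y))
    (hh : h =ᶠ[𝓝 y] g ∘ f) :
    volumeScaling h y = |(fderiv ℝ f y).det| * volumeScaling g (f y) := by
  have h1 : (mfderiv (𝓡 d) (𝓡 d) h y : EuclideanSpace ℝ (Fin d) →L[ℝ] EuclideanSpace ℝ (Fin d))
      = (mfderiv (𝓡 d) (𝓡 d) g (f y) : EuclideanSpace ℝ (Fin d) →L[ℝ] EuclideanSpace ℝ (Fin d))
        ∘L fderiv ℝ f y := by
    have := mfderiv_comp y hg hf.mdifferentiableAt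
    rw [← hh.mfderiv_eq, mfderiv_eq_fderiv] at this
    exact this
  have h2 : volumeScaling h y
      = LinearMap.normDet (U := EuclideanSpace ℝ (Fin d)) (V := TangentSpace (𝓡 d) (g (f y)))
        (ContinuousLinearMap.toLinearMap (M := EuclideanSpace ℝ (Fin d))
          (M₂ := EuclideanSpace ℝ (Fin d)) (mfderiv (𝓡 d) (𝓡 d) h y)) :=
    normDet_tangentSpace_congr hh.eq_of_nhds _
  have h3 := LinearMap.normDet_comp_of_finrank_eq (U := EuclideanSpace ℝ (Fin d))
    (V := EuclideanSpace ℝ (Fin d)) (W := TangentSpace (𝓡 d) (g (f y)))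
    (fderiv ℝ f y).toLinearMap (mfderiv (𝓡 d) (𝓡 d) g (f y)).toLinearMap rfl
  rw [h2, h1, mul_comm]
  refine h3.trans ?_
  rw [LinearMap.normDet_eq_abs_det]
  rfl

theorem volumeScaling_comp_left {F : M → M} {g : EuclideanSpace ℝ (Fin d) → M}
    {y : EuclideanSpace ℝ (Fin d)} (hF : MDifferentiableAt (𝓡 d) (𝓡 d) F (g y))
    (hg : MDifferentiableAt (𝓡 d) (𝓡 d) g y) :
    volumeScaling (F ∘ g) y = riemannianJacobian d F (g y) * volumeScaling g y := by
  rw [riemannianJacobian, absDet_eq_normDet]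
  have := mfderiv_comp y hF hg
  rw [volumeScaling, this]
  exact LinearMap.normDet_comp_of_finrank_eq (U := EuclideanSpace ℝ (Fin d))
    (V := TangentSpace (𝓡 d) (g y)) (W := TangentSpace (𝓡 d) (F (g y))) _ _ rfl

end Volume

/-! ### The Riemannian volume as a measure: independence of the chart and local finiteness. -/

section VolumeMeasure

theorem ContinuousOn.measurableSet_inter_preimage {Y Z : Type*} [TopologicalSpace Y]
    [MeasurableSpace Y] [OpensMeasurableSpace Y] [TopologicalSpace Z] [MeasurableSpace Z]
    [BorelSpace Z] {f : Y → Z} {s : Set Y} (hf : ContinuousOn f s) (hs : MeasurableSet s)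
    {t : Set Z} (ht : MeasurableSet t) : MeasurableSet (s ∩ f ⁻¹' t) := by
  have h := hs.subtype_image ((continuousOn_iff_continuous_domRestrict.1 hf).measurable ht)
  convert h using 1
  ext x
  simp [and_comm]

theorem image_symm_eq_preimage_chart {d : ℕ} {M : Type*} [TopologicalSpace M]
    [ChartedSpace (EuclideanSpace ℝ (Fin d)) M] {p : M} {S : Set M}
    (hS : S ⊆ (chartAt (EuclideanSpace ℝ (Fin d)) p).source) :
    (chartAt (EuclideanSpace ℝ (Fin d)) p).symm ⁻¹' S
        ∩ (chartAt (EuclideanSpace ℝ (Fin d)) p).target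
      = chartAt (EuclideanSpace ℝ (Fin d)) p '' S := by
  rw [(chartAt (EuclideanSpace ℝ (Fin d)) p).image_eq_target_inter_inv_preimage hS, inter_comm]

variable {d : ℕ} {M : Type*} [TopologicalSpace M] [ChartedSpace (EuclideanSpace ℝ (Fin d)) M]
  [RiemannianBundle (fun x : M => TangentSpace (𝓡 d) x)] [MeasurableSpace M] [BorelSpace M]

theorem chartVolume_apply (p : M) {S : Set M} (hS : MeasurableSet S) :
    chartVolume d p S = ∫⁻ y in (chartAt (EuclideanSpace ℝ (Fin d)) p).symm ⁻¹' S
      ∩ (chartAt (EuclideanSpace ℝ (Fin d)) p).target, ENNReal.ofReal (volumeDensity d p y) := by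
  set φ := chartAt (EuclideanSpace ℝ (Fin d)) p
  have h1 : AEMeasurable φ.symm (volume.restrict φ.target) :=
    φ.continuousOn_symm.aemeasurable φ.open_target.measurableSet
  rw [chartVolume, Measure.map_apply_of_aemeasurable
    (h1.mono_ac (withDensity_absolutelyContinuous _ _)) hS, withDensity_apply',
    Measure.restrict_restrict' φ.open_target.measurableSet]

theorem chartVolume_apply_of_subset (p : M) {S : Set M} (hS : MeasurableSet S)
    (hsub : S ⊆ (chartAt (EuclideanSpace ℝ (Fin d)) p).source) :
    chartVolume d p S = ∫⁻ y in chartAt (EuclideanSpace ℝ (Fin d)) p '' S,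
      ENNReal.ofReal (volumeDensity d p y) := by
  rw [chartVolume_apply p hS, image_symm_eq_preimage_chart hsub]

theorem chartVolume_inter_source (p : M) {S : Set M} (hS : MeasurableSet S) :
    chartVolume d p (S ∩ (chartAt (EuclideanSpace ℝ (Fin d)) p).source) = chartVolume d p S := by
  set φ := chartAt (EuclideanSpace ℝ (Fin d)) p
  rw [chartVolume_apply p hS, chartVolume_apply p (hS.inter φ.open_source.measurableSet)]
  congr 2
  ext y
  simp only [preimage_inter, mem_inter_iff, mem_preimage]
  exact ⟨fun h => ⟨h.1.1, h.2⟩, fun h => ⟨⟨h.1, φ.map_target h.2⟩, h.2⟩⟩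

/-- The Riemannian volume of a parametrized set. -/
theorem chartVolume_image [T2Space M] [IsManifold (𝓡 d) 1 M] (q : M)
    {g : EuclideanSpace ℝ (Fin d) → M} {O A : Set (EuclideanSpace ℝ (Fin d))} (hO : IsOpen O)
    (hg : ContMDiffOn (𝓡 d) (𝓡 d) 1 g O) (hinj : InjOn g O) (hA : MeasurableSet A) (hAO : A ⊆ O)
    (hgA : g '' A ⊆ (chartAt (EuclideanSpace ℝ (Fin d)) q).source) :
    chartVolume d q (g '' A) = ∫⁻ y in A, ENNReal.ofReal (volumeScaling g y) := by
  set φ := chartAt (EuclideanSpace ℝ (Fin d)) q with hφ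
  have hgAm : MeasurableSet (g '' A) :=
    hA.image_of_continuousOn_injOn (hg.continuousOn.mono hAO) (hinj.mono hAO)
  have hmaps : MapsTo g A φ.source := mapsTo_iff_image_subset.2 hgA
  have hdiff : ∀ y ∈ A, DifferentiableAt ℝ (φ ∘ g) y := by
    intro y hy
    have h1 : MDifferentiableAt (𝓡 d) (𝓡 d) g y :=
      ((hg y (hAO hy)).contMDiffAt (hO.mem_nhds (hAO hy))).mdifferentiableAt one_ne_zero
    have h2 : MDifferentiableAt (𝓡 d) (𝓡 d) φ (g y) :=
      ((contMDiffOn_chart (n := 1) _ (hmaps hy)).contMDiffAt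
        (φ.open_source.mem_nhds (hmaps hy))).mdifferentiableAt one_ne_zero
    exact (h2.comp y h1).differentiableAt
  -- The Euclidean change of variables for `φ ∘ g`; its determinant combines with the density by the
  -- chain rule for `g = φ.symm ∘ (φ ∘ g)`.
  rw [chartVolume_apply_of_subset q hgAm hgA, ← image_comp,
    lintegral_image_eq_lintegral_abs_det_fderiv_mul volume hA
      (fun y hy => (hdiff y hy).hasFDerivAt.hasFDerivWithinAt)
      ((φ.injOn.comp (hinj.mono hAO) hmaps))]
  refine setLIntegral_congr_fun hA fun y hy => ?_
  have hsymm : MDifferentiableAt (𝓡 d) (𝓡 d) φ.symm ((φ ∘ g) y) := by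
    have ht : (φ ∘ g) y ∈ φ.target := φ.map_source (hmaps hy)
    exact ((contMDiffOn_chart_symm (n := 1) _ ht).contMDiffAt
      (φ.open_target.mem_nhds ht)).mdifferentiableAt one_ne_zero
  have heq : g =ᶠ[𝓝 y] φ.symm ∘ (φ ∘ g) := by
    have hc : ContinuousAt g y := (hg.continuousOn y (hAO hy)).continuousAt (hO.mem_nhds (hAO hy))
    filter_upwards [hc.preimage_mem_nhds (φ.open_source.mem_nhds (hmaps hy))] with z hz
    exact (φ.left_inv hz).symm
  rw [volumeScaling_comp (hdiff y hy) hsymm heq, ENNReal.ofReal_mul (abs_nonneg _),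
    volumeDensity_eq_volumeScaling]

/-- The formula for parametrized sets, with the inverse of the chart at `p` as parametrization. -/
theorem chartVolume_eq_of_subset [T2Space M] [IsManifold (𝓡 d) 1 M] (p q : M) {S : Set M}
    (hS : MeasurableSet S) (hp : S ⊆ (chartAt (EuclideanSpace ℝ (Fin d)) p).source)
    (hq : S ⊆ (chartAt (EuclideanSpace ℝ (Fin d)) q).source) :
    chartVolume d q S = chartVolume d p S := by
  set φ := chartAt (EuclideanSpace ℝ (Fin d)) p with hφ
  have hm : MeasurableSet (φ '' S) := by
    rw [← image_symm_eq_preimage_chart hp, inter_comm]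
    exact φ.continuousOn_symm.measurableSet_inter_preimage φ.open_target.measurableSet hS
  have himg : φ.symm '' (φ '' S) = S := by
    rw [← image_comp]
    exact (image_congr fun x hx => φ.left_inv (hp hx)).trans (image_id _)
  have h := chartVolume_image q φ.open_target (contMDiffOn_chart_symm (n := 1)) φ.symm.injOn hm
    (by rintro _ ⟨x, hx, rfl⟩; exact φ.map_source (hp hx)) (by rwa [himg])
  rw [himg] at h
  rw [h, chartVolume_apply_of_subset p hS hp]
  simp_rw [volumeDensity_eq_volumeScaling]
  rfl

/-- The supremum of measures is not taken setwise, so a measure is exhibited that bounds every chart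
measure: that of `p` on its chart domain, plus the whole volume outside it. On `S` the second
summand vanishes. -/
theorem riemannianVolume_eq_chartVolume [T2Space M] [IsManifold (𝓡 d) 1 M] (p : M) {S : Set M}
    (hS : MeasurableSet S) (hp : S ⊆ (chartAt (EuclideanSpace ℝ (Fin d)) p).source) :
    riemannianVolume d M S = chartVolume d p S := by
  set φ := chartAt (EuclideanSpace ℝ (Fin d)) p with hφ
  refine le_antisymm ?_ (Measure.le_iff.1 (le_iSup (fun p : M => chartVolume d p) p) S hS)
  have hsm : MeasurableSet φ.source := φ.open_source.measurableSet
  have hle : riemannianVolume d M ≤ (chartVolume d p).restrict φ.source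
      + (riemannianVolume d M).restrict φ.sourceᶜ := by
    refine iSup_le fun q => Measure.le_iff.2 fun T hT => ?_
    set ψ := chartAt (EuclideanSpace ℝ (Fin d)) q
    rw [← measure_inter_add_sdiff T hsm, Measure.add_apply, Measure.restrict_apply hT,
      Measure.restrict_apply hT]
    refine add_le_add ?_ ?_
    · rw [← chartVolume_inter_source q (hT.inter hsm),
        chartVolume_eq_of_subset p q ((hT.inter hsm).inter ψ.open_source.measurableSet)
          (inter_subset_left.trans inter_subset_right) inter_subset_right]
      exact measure_mono inter_subset_left
    · exact Measure.le_iff.1 (le_iSup (fun p : M => chartVolume d p) q) _ (hT.inter hsm.compl)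
  refine (Measure.le_iff.1 hle S hS).trans ?_
  rw [Measure.add_apply, Measure.restrict_apply hS, Measure.restrict_apply hS,
    inter_eq_left.2 hp, (disjoint_compl_right_iff_subset.2 hp).inter_eq]
  simp

theorem isLocallyFiniteMeasure_riemannianVolume [T2Space M] [IsManifold (𝓡 d) 1 M]
    [IsContinuousRiemannianBundle (EuclideanSpace ℝ (Fin d))
      (fun x : M => TangentSpace (𝓡 d) x)] :
    IsLocallyFiniteMeasure (riemannianVolume d M) := by
  refine ⟨fun p => ?_⟩
  set φ := chartAt (EuclideanSpace ℝ (Fin d)) p with hφ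
  have hps : p ∈ φ.source := mem_chart_source _ p
  have hpt : φ p ∈ φ.target := φ.map_source hps
  have hcont : ContinuousOn (volumeDensity d p) φ.target := by
    rw [funext (volumeDensity_eq_volumeScaling p)]
    exact continuousOn_volumeScaling φ.open_target (contMDiffOn_chart_symm (n := 1))
  have hca : ContinuousAt (volumeDensity d p) (φ p) :=
    (hcont _ hpt).continuousAt (φ.open_target.mem_nhds hpt)
  have hev : ∀ᶠ y in 𝓝 (φ p), volumeDensity d p y < volumeDensity d p (φ p) + 1 :=
    hca.eventually (gt_mem_nhds (by linarith))
  obtain ⟨r, hr, hball⟩ := Metric.mem_nhds_iff.1 (inter_mem hev (φ.open_target.mem_nhds hpt))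
  set V := φ.source ∩ φ ⁻¹' Metric.ball (φ p) r with hV
  have hVo : IsOpen V := φ.isOpen_inter_preimage Metric.isOpen_ball
  refine ⟨V, hVo.mem_nhds ⟨hps, by simpa using hr⟩, ?_⟩
  rw [riemannianVolume_eq_chartVolume p hVo.measurableSet inter_subset_left,
    chartVolume_apply_of_subset p hVo.measurableSet inter_subset_left]
  calc ∫⁻ y in φ '' V, ENNReal.ofReal (volumeDensity d p y)
      ≤ ∫⁻ y in Metric.ball (φ p) r, ENNReal.ofReal (volumeDensity d p y) := by
        refine lintegral_mono_set ?_
        rintro _ ⟨x, hx, rfl⟩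
        exact hx.2
    _ ≤ ∫⁻ y in Metric.ball (φ p) r, ENNReal.ofReal (volumeDensity d p (φ p) + 1) :=
        setLIntegral_mono measurable_const fun y hy => ENNReal.ofReal_le_ofReal (hball hy).1.le
    _ < ⊤ := by
        rw [setLIntegral_const]
        exact ENNReal.mul_lt_top ENNReal.ofReal_lt_top measure_ball_lt_top

end VolumeMeasure

/-! ### Change of variables on the manifold. -/

section ChangeOfVariables

variable {d : ℕ} {M : Type*} [TopologicalSpace M] [ChartedSpace (EuclideanSpace ℝ (Fin d)) M]
  [RiemannianBundle (fun x : M => TangentSpace (𝓡 d) x)]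

theorem volumeDensity_pos [IsManifold (𝓡 d) 1 M] (p : M) {y : EuclideanSpace ℝ (Fin d)}
    (hy : y ∈ (chartAt (EuclideanSpace ℝ (Fin d)) p).target) : 0 < volumeDensity d p y := by
  set φ := chartAt (EuclideanSpace ℝ (Fin d)) p with hφ
  rw [volumeDensity_eq_volumeScaling]
  refine lt_of_le_of_ne (LinearMap.normDet_nonneg (U := EuclideanSpace ℝ (Fin d))
    (V := TangentSpace (𝓡 d) (φ.symm y)) _) (Ne.symm ?_)
  have h1 : MDifferentiableAt (𝓡 d) (𝓡 d) φ.symm y :=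
    ((contMDiffOn_chart_symm (n := 1) _ hy).contMDiffAt
      (φ.open_target.mem_nhds hy)).mdifferentiableAt one_ne_zero
  have hs := φ.map_target hy
  have h2 : MDifferentiableAt (𝓡 d) (𝓡 d) φ (φ.symm y) :=
    ((contMDiffOn_chart (n := 1) _ hs).contMDiffAt
      (φ.open_source.mem_nhds hs)).mdifferentiableAt one_ne_zero
  have h3 : φ ∘ φ.symm =ᶠ[𝓝 y] id := by
    filter_upwards [φ.open_target.mem_nhds hy] with z hz
    exact φ.right_inv hz
  have h4 := mfderiv_comp y h2 h1
  rw [h3.mfderiv_eq, mfderiv_id] at h4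
  refine ((LinearMap.normDet_ne_zero_tfae (U := EuclideanSpace ℝ (Fin d))
    (V := TangentSpace (𝓡 d) (φ.symm y))
    (mfderiv (𝓡 d) (𝓡 d) φ.symm y).toLinearMap).out 0 4).2 fun v w hvw => ?_
  have hv := congrArg (fun A : EuclideanSpace ℝ (Fin d) →L[ℝ] EuclideanSpace ℝ (Fin d) => A v) h4
  have hw := congrArg (fun A : EuclideanSpace ℝ (Fin d) →L[ℝ] EuclideanSpace ℝ (Fin d) => A w) h4
  exact (hv.trans (congrArg (mfderiv (𝓡 d) (𝓡 d) φ (φ.symm y)) hvw)).trans hw.symm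

/-- In a chart the Jacobian is the quotient of the volume scalings of `F ∘ φ.symm` and `φ.symm`, the
latter being positive. -/
theorem continuousOn_riemannianJacobian [IsManifold (𝓡 d) 1 M]
    [IsContinuousRiemannianBundle (EuclideanSpace ℝ (Fin d))
      (fun x : M => TangentSpace (𝓡 d) x)] {F : M → M} {U : Set M} (hU : IsOpen U)
    (hF : ContMDiffOn (𝓡 d) (𝓡 d) 1 F U) : ContinuousOn (riemannianJacobian d F) U := by
  intro x hx
  refine ContinuousAt.continuousWithinAt ?_
  set φ := chartAt (EuclideanSpace ℝ (Fin d)) x with hφ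
  have hxs : x ∈ φ.source := mem_chart_source _ x
  set O := φ.target ∩ φ.symm ⁻¹' U with hO
  have hOo : IsOpen O := φ.isOpen_inter_preimage_symm hU
  have hsymm : ContMDiffOn (𝓡 d) (𝓡 d) 1 φ.symm φ.target := contMDiffOn_chart_symm
  have hg : ContMDiffOn (𝓡 d) (𝓡 d) 1 (F ∘ φ.symm) O :=
    hF.comp (hsymm.mono inter_subset_left) inter_subset_right
  have hxO : φ x ∈ O := ⟨φ.map_source hxs, by
    change φ.symm (φ x) ∈ U
    rwa [φ.left_inv hxs]⟩
  have h1 : ContinuousOn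
      (fun y => volumeScaling (F ∘ φ.symm) y / volumeScaling φ.symm y) O := by
    refine (continuousOn_volumeScaling hOo hg).div
      ((continuousOn_volumeScaling φ.open_target hsymm).mono inter_subset_left) fun y hy => ?_
    have := volumeDensity_pos x hy.1
    rw [volumeDensity_eq_volumeScaling] at this
    exact this.ne'
  have h2 : ContinuousAt
      ((fun y => volumeScaling (F ∘ φ.symm) y / volumeScaling φ.symm y) ∘ φ) x :=
    ((h1 _ hxO).continuousAt (hOo.mem_nhds hxO)).comp (φ.continuousAt hxs)
  refine h2.congr ?_
  filter_upwards [φ.open_source.mem_nhds hxs, hU.mem_nhds hx] with z hzs hzU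
  have hzt := φ.map_source hzs
  have hz := φ.left_inv hzs
  have hpos := volumeDensity_pos x hzt
  rw [volumeDensity_eq_volumeScaling] at hpos
  have hF' : MDifferentiableAt (𝓡 d) (𝓡 d) F (φ.symm (φ z)) := by
    rw [hz]
    exact ((hF z hzU).contMDiffAt (hU.mem_nhds hzU)).mdifferentiableAt one_ne_zero
  have hs' : MDifferentiableAt (𝓡 d) (𝓡 d) φ.symm (φ z) :=
    ((hsymm _ hzt).contMDiffAt (φ.open_target.mem_nhds hzt)).mdifferentiableAt one_ne_zero
  have h3 := volumeScaling_comp_left hF' hs'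
  change volumeScaling (F ∘ φ.symm) (φ z) / volumeScaling φ.symm (φ z) = _
  rw [h3, mul_div_cancel_right₀ _ hpos.ne', hz]

variable [MeasurableSpace M] [BorelSpace M]

theorem setLIntegral_chartVolume [IsManifold (𝓡 d) 1 M]
    [IsContinuousRiemannianBundle (EuclideanSpace ℝ (Fin d))
      (fun x : M => TangentSpace (𝓡 d) x)] (p : M) {S : Set M} (hS : MeasurableSet S)
    (hsub : S ⊆ (chartAt (EuclideanSpace ℝ (Fin d)) p).source) {f : M → ℝ≥0∞} (hf : Measurable f) :
    ∫⁻ x in S, f x ∂(chartVolume d p)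
      = ∫⁻ y in chartAt (EuclideanSpace ℝ (Fin d)) p '' S, ENNReal.ofReal (volumeDensity d p y)
        * f ((chartAt (EuclideanSpace ℝ (Fin d)) p).symm y) := by
  set φ := chartAt (EuclideanSpace ℝ (Fin d)) p with hφ
  have ht : MeasurableSet φ.target := φ.open_target.measurableSet
  have h1 : AEMeasurable φ.symm (volume.restrict φ.target) :=
    φ.continuousOn_symm.aemeasurable ht
  have hdens : AEMeasurable (fun y => ENNReal.ofReal (volumeDensity d p y))
      (volume.restrict φ.target) := by
    rw [funext (volumeDensity_eq_volumeScaling p)]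
    exact ((continuousOn_volumeScaling φ.open_target
      (contMDiffOn_chart_symm (n := 1))).aemeasurable ht).ennreal_ofReal
  have hSi : Measurable (S.indicator f) := hf.indicator hS
  have hm : MeasurableSet (φ '' S) := by
    rw [← image_symm_eq_preimage_chart hsub, inter_comm]
    exact φ.continuousOn_symm.measurableSet_inter_preimage ht hS
  have himg : φ '' S ⊆ φ.target := by
    rintro _ ⟨x, hx, rfl⟩
    exact φ.map_source (hsub hx)
  have hcomp : AEMeasurable (fun y => S.indicator f (φ.symm y)) (volume.restrict φ.target) :=
    hSi.comp_aemeasurable h1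
  rw [← lintegral_indicator hS, chartVolume, lintegral_map' hSi.aemeasurable
    (h1.mono_ac (withDensity_absolutelyContinuous _ _)),
    lintegral_withDensity_eq_lintegral_mul₀ hdens hcomp,
    ← inter_eq_left.2 himg, ← setLIntegral_indicator hm]
  refine setLIntegral_congr_fun ht fun y hy => ?_
  by_cases hyS : φ.symm y ∈ S
  · have : y ∈ φ '' S := ⟨_, hyS, φ.right_inv hy⟩
    simp [hyS, this]
  · have : y ∉ φ '' S := by
      rintro ⟨x, hx, rfl⟩
      exact hyS (by rwa [φ.left_inv (hsub hx)])
    simp [hyS, this]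

/-- `F ∘ φ.symm` parametrizes `F '' S`, and its scaling is the Jacobian times the density of the
chart. The function `f` is a globally measurable extension of the Jacobian from `U`. -/
theorem riemannianVolume_image_of_subset_chart [T2Space M] [IsManifold (𝓡 d) 1 M]
    [IsContinuousRiemannianBundle (EuclideanSpace ℝ (Fin d))
      (fun x : M => TangentSpace (𝓡 d) x)] {F : M → M} {U : Set M} (hU : IsOpen U)
    (hF : ContMDiffOn (𝓡 d) (𝓡 d) 1 F U) (hinj : InjOn F U) {f : M → ℝ≥0∞} (hf : Measurable f)
    (hfJ : ∀ x ∈ U, f x = ENNReal.ofReal (riemannianJacobian d F x)) (p q : M) {S : Set M}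
    (hS : MeasurableSet S) (hSU : S ⊆ U)
    (hp : S ⊆ (chartAt (EuclideanSpace ℝ (Fin d)) p).source)
    (hq : MapsTo F S (chartAt (EuclideanSpace ℝ (Fin d)) q).source) (hFS : MeasurableSet (F '' S)) :
    riemannianVolume d M (F '' S) = ∫⁻ x in S, f x ∂(riemannianVolume d M) := by
  set φ := chartAt (EuclideanSpace ℝ (Fin d)) p with hφ
  have hsymm : ContMDiffOn (𝓡 d) (𝓡 d) 1 φ.symm φ.target := contMDiffOn_chart_symm
  set O := φ.target ∩ φ.symm ⁻¹' U with hO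
  have hOo : IsOpen O := φ.isOpen_inter_preimage_symm hU
  have hg : ContMDiffOn (𝓡 d) (𝓡 d) 1 (F ∘ φ.symm) O :=
    hF.comp (hsymm.mono inter_subset_left) inter_subset_right
  have hginj : InjOn (F ∘ φ.symm) O :=
    hinj.comp (φ.symm.injOn.mono inter_subset_left) inter_subset_right
  have hm : MeasurableSet (φ '' S) := by
    rw [← image_symm_eq_preimage_chart hp, inter_comm]
    exact φ.continuousOn_symm.measurableSet_inter_preimage φ.open_target.measurableSet hS
  have hsub : φ '' S ⊆ O := by
    rintro _ ⟨x, hx, rfl⟩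
    refine ⟨φ.map_source (hp hx), ?_⟩
    change φ.symm (φ x) ∈ U
    rw [φ.left_inv (hp hx)]
    exact hSU hx
  have himg : (F ∘ φ.symm) '' (φ '' S) = F '' S := by
    rw [← image_comp]
    exact image_congr fun x hx => congrArg F (φ.left_inv (hp hx))
  have hvol : (riemannianVolume d M).restrict S = (chartVolume d p).restrict S := by
    ext T hT
    rw [Measure.restrict_apply hT, Measure.restrict_apply hT,
      riemannianVolume_eq_chartVolume p (hT.inter hS) (inter_subset_right.trans hp)]
  have h := chartVolume_image q hOo hg hginj hm hsub (by
    rw [himg]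
    exact mapsTo_iff_image_subset.1 hq)
  rw [himg] at h
  rw [hvol, setLIntegral_chartVolume p hS hp hf,
    riemannianVolume_eq_chartVolume q hFS (mapsTo_iff_image_subset.1 hq), h]
  refine setLIntegral_congr_fun hm fun y hy => ?_
  have hyO := hsub hy
  have hFy : MDifferentiableAt (𝓡 d) (𝓡 d) F (φ.symm y) :=
    ((hF _ hyO.2).contMDiffAt (hU.mem_nhds hyO.2)).mdifferentiableAt one_ne_zero
  have hsy : MDifferentiableAt (𝓡 d) (𝓡 d) φ.symm y :=
    ((hsymm _ hyO.1).contMDiffAt (φ.open_target.mem_nhds hyO.1)).mdifferentiableAt one_ne_zero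
  have hpos := volumeDensity_pos p hyO.1
  rw [hfJ _ hyO.2, ← ENNReal.ofReal_mul hpos.le, volumeScaling_comp_left hFy hsy,
    volumeDensity_eq_volumeScaling, mul_comm]

/-- The change of variables formula for the Riemannian volume. -/
theorem riemannianVolume_image [T2Space M] [SecondCountableTopology M] [IsManifold (𝓡 d) 1 M]
    [IsContinuousRiemannianBundle (EuclideanSpace ℝ (Fin d))
      (fun x : M => TangentSpace (𝓡 d) x)] (Φ : PartialDiffeomorph (𝓡 d) (𝓡 d) M M 2) {F : M → M}
    (hFm : Measurable F) (hF : EqOn F Φ Φ.source) {f : M → ℝ≥0∞} (hf : Measurable f)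
    (hfJ : ∀ x ∈ Φ.source, f x = ENNReal.ofReal (riemannianJacobian d F x)) {S : Set M}
    (hS : MeasurableSet S) (hSU : S ⊆ Φ.source) :
    riemannianVolume d M (F '' S) = ∫⁻ x in S, f x ∂(riemannianVolume d M) := by
  set U := Φ.source with hUdef
  have hU : IsOpen U := Φ.open_source
  have hUm : MeasurableSet U := hU.measurableSet
  have hT : MeasurableSet Φ.target := Φ.open_target.measurableSet
  have hFc : ContMDiffOn (𝓡 d) (𝓡 d) 1 F U := (Φ.contMDiffOn_toFun.of_le one_le_two).congr hF
  have hinj : InjOn F U := Φ.injOn.congr hF.symm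
  have hΦc : ContinuousOn Φ.symm Φ.target := Φ.contMDiffOn_invFun.continuousOn
  have himg : ∀ A, F '' (A ∩ U) = Φ.target ∩ Φ.symm ⁻¹' A := by
    intro A
    ext y
    constructor
    · rintro ⟨x, hx, rfl⟩
      rw [hF hx.2]
      refine ⟨Φ.map_source hx.2, ?_⟩
      change Φ.symm (Φ x) ∈ A
      rw [show Φ.symm (Φ x) = x from Φ.left_inv hx.2]
      exact hx.1
    · rintro ⟨hy, hyA⟩
      refine ⟨Φ.symm y, ⟨hyA, Φ.map_target hy⟩, ?_⟩
      exact (hF (Φ.map_target hy)).trans (Φ.right_inv hy)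
  have himgm : ∀ A, MeasurableSet A → MeasurableSet (F '' (A ∩ U)) := fun A hA => by
    rw [himg]
    exact hΦc.measurableSet_inter_preimage hT hA
  -- Both sides of the formula are measures in `S`, so it suffices to compare them on the sets of a
  -- countable cover: those lying in one chart domain and mapped by `F` into one chart domain.
  set ν₁ := Measure.map Φ.symm ((riemannianVolume d M).restrict Φ.target) with hν₁
  set ν₂ := ((riemannianVolume d M).restrict U).withDensity f with hν₂
  have h1 : ∀ A, MeasurableSet A → ν₁ A = riemannianVolume d M (F '' (A ∩ U)) := fun A hA => by
    rw [hν₁, Measure.map_apply_of_aemeasurable (hΦc.aemeasurable hT) hA,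
      Measure.restrict_apply' hT, himg, inter_comm]
  have h2 : ∀ A, MeasurableSet A → ν₂ A = ∫⁻ x in A ∩ U, f x ∂(riemannianVolume d M) :=
    fun A hA => by
      rw [hν₂, withDensity_apply _ hA, Measure.restrict_restrict hA]
  obtain ⟨t, ht, hcov⟩ := countable_cover_nhds (X := M)
    (U := fun p => (chartAt (EuclideanSpace ℝ (Fin d)) p).source) fun p => chart_source_mem_nhds _ p
  have hcov' : ∀ x : M, ∃ p : t, x ∈ (chartAt (EuclideanSpace ℝ (Fin d)) (p : M)).source := by
    intro x
    have : x ∈ ⋃ p ∈ t, (chartAt (EuclideanSpace ℝ (Fin d)) p).source := hcov ▸ mem_univ x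
    simp only [mem_iUnion] at this
    obtain ⟨p, hp, hx⟩ := this
    exact ⟨⟨p, hp⟩, hx⟩
  have := ht.to_subtype
  set V : t × t → Set M := fun a =>
    (chartAt (EuclideanSpace ℝ (Fin d)) (a.1 : M)).source
      ∩ F ⁻¹' (chartAt (EuclideanSpace ℝ (Fin d)) (a.2 : M)).source with hV
  have hVm : ∀ a, MeasurableSet (V a) := fun a =>
    (chartAt (EuclideanSpace ℝ (Fin d)) (a.1 : M)).open_source.measurableSet.inter
      (hFm (chartAt (EuclideanSpace ℝ (Fin d)) (a.2 : M)).open_source.measurableSet)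
  have hVu : ⋃ a, V a = univ := by
    refine eq_univ_of_forall fun x => ?_
    obtain ⟨p, hp⟩ := hcov' x
    obtain ⟨q, hq⟩ := hcov' (F x)
    exact mem_iUnion.2 ⟨(p, q), hp, hq⟩
  have heq : ν₁ = ν₂ := by
    refine (Measure.ext_iff_of_iUnion_eq_univ hVu).2 fun a => ?_
    ext A hA
    have hAV := hA.inter (hVm a)
    rw [Measure.restrict_apply hA, Measure.restrict_apply hA, h1 _ hAV, h2 _ hAV]
    exact riemannianVolume_image_of_subset_chart hU hFc hinj hf hfJ a.1 a.2 (hAV.inter hUm)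
      inter_subset_right (fun x hx => hx.1.2.1) (fun x hx => hx.1.2.2) (himgm _ hAV)
  have h3 := h1 S hS
  rw [heq, h2 S hS, inter_eq_left.2 hSU] at h3
  exact h3.symm

end ChangeOfVariables

/-! ### Piecewise expanding Markov maps -/

section Markov

theorem ContinuousLinearMap.normDet_le_one {V W : Type*} [NormedAddCommGroup V]
    [InnerProductSpace ℝ V] [FiniteDimensional ℝ V] [NormedAddCommGroup W] [InnerProductSpace ℝ W]
    [FiniteDimensional ℝ W] {A : V →L[ℝ] W} (hA : ‖A‖ ≤ 1) : A.toLinearMap.normDet ≤ 1 :=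
  LinearMap.normDet_le_one fun v =>
    (A.le_opNorm v).trans (mul_le_of_le_one_left (norm_nonneg v) hA)

variable {d : ℕ} {M : Type*} [EMetricSpace M] [ChartedSpace (EuclideanSpace ℝ (Fin d)) M]
  [RiemannianBundle (fun x : M => TangentSpace (𝓡 d) x)]

theorem normDet_tangentSpace_hom_congr {a b c : M} (h : a = b)
    (A : EuclideanSpace ℝ (Fin d) →ₗ[ℝ] EuclideanSpace ℝ (Fin d)) :
    LinearMap.normDet (U := TangentSpace (𝓡 d) c) (V := TangentSpace (𝓡 d) a) A
      = LinearMap.normDet (U := TangentSpace (𝓡 d) c) (V := TangentSpace (𝓡 d) b) A := by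
  subst h
  rfl

/-- The scalings of `DF` and of the derivative of the inverse branch multiply to `1`, and the latter
is at most `1` because the inverse branch contracts. -/
theorem PartialDiffeomorph.one_le_riemannianJacobian
    (Φ : PartialDiffeomorph (𝓡 d) (𝓡 d) M M 2) {F : M → M} (hF : EqOn F Φ Φ.source)
    (hκ : ∀ x ∈ Φ.source, ‖(mfderiv (𝓡 d) (𝓡 d) F x).inverse‖ < 1) {x : M}
    (hx : x ∈ Φ.source) : 1 ≤ riemannianJacobian d F x := by
  obtain ⟨y, hy, rfl⟩ : ∃ y ∈ Φ.target, Φ.symm y = x :=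
    ⟨Φ x, Φ.map_source hx, Φ.left_inv hx⟩
  have hFy : F (Φ.symm y) = y := (hF hx).trans (Φ.right_inv hy)
  have h1 := congrArg ContinuousLinearMap.toLinearMap (Φ.mfderiv_comp_mfderiv_symm hF hy)
  have h2 : LinearMap.normDet (mfderiv (𝓡 d) (𝓡 d) Φ.symm y).toLinearMap ≤ 1 :=
    ContinuousLinearMap.normDet_le_one (Φ.norm_mfderiv_symm_lt hF hκ hy).le
  have h3 := LinearMap.normDet_comp_of_finrank_eq (U := TangentSpace (𝓡 d) y)
    (V := TangentSpace (𝓡 d) (Φ.symm y)) (W := TangentSpace (𝓡 d) (F (Φ.symm y)))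
    (mfderiv (𝓡 d) (𝓡 d) Φ.symm y).toLinearMap
    (mfderiv (𝓡 d) (𝓡 d) F (Φ.symm y)).toLinearMap rfl
  have h4 : LinearMap.normDet (U := TangentSpace (𝓡 d) y)
      (V := TangentSpace (𝓡 d) (F (Φ.symm y)))
      ((mfderiv (𝓡 d) (𝓡 d) F (Φ.symm y)).toLinearMap ∘ₗ
        (mfderiv (𝓡 d) (𝓡 d) Φ.symm y).toLinearMap) = 1 := by
    refine Eq.trans ?_ ((normDet_tangentSpace_hom_congr (c := y) hFy LinearMap.id).trans
      (LinearMap.normDet_id (U := TangentSpace (𝓡 d) y)))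
    exact congrArg (LinearMap.normDet (U := TangentSpace (𝓡 d) y)
      (V := TangentSpace (𝓡 d) (F (Φ.symm y)))) h1
  rw [riemannianJacobian, absDet_eq_normDet]
  have h5 := LinearMap.normDet_nonneg (mfderiv (𝓡 d) (𝓡 d) F (Φ.symm y)).toLinearMap
  have h6 := h3.symm.trans h4
  nlinarith

end Markov

/-- Distances in a compact space are bounded, up to infinite ones. -/
theorem exists_forall_edist_toReal_le (X : Type*) [EMetricSpace X] [CompactSpace X] :
    ∃ D, ∀ x y : X, (edist x y).toReal ≤ D := by
  obtain ⟨t, -, ht, hcov⟩ := EMetric.totallyBounded_iff'.1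
    (isCompact_univ (X := X)).totallyBounded 1 one_pos
  have hpick : ∀ x : X, ∃ c ∈ ht.toFinset, edist x c < 1 := by
    intro x
    have := hcov (mem_univ x)
    simp only [mem_iUnion] at this
    obtain ⟨c, hc, hxc⟩ := this
    exact ⟨c, ht.mem_toFinset.2 hc, hxc⟩
  refine ⟨2 + ∑ c ∈ ht.toFinset, ∑ c' ∈ ht.toFinset, (edist c c').toReal, fun x y => ?_⟩
  obtain ⟨a, ha, hxa⟩ := hpick x
  obtain ⟨b, hb, hyb⟩ := hpick y
  have h1 : (edist a b).toReal ≤ ∑ c ∈ ht.toFinset, ∑ c' ∈ ht.toFinset, (edist c c').toReal :=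
    (Finset.single_le_sum (f := fun c' => (edist a c').toReal)
      (fun _ _ => ENNReal.toReal_nonneg) hb).trans
      (Finset.single_le_sum (f := fun c => ∑ c' ∈ ht.toFinset, (edist c c').toReal)
        (fun _ _ => Finset.sum_nonneg fun _ _ => ENNReal.toReal_nonneg) ha)
  have h2 : 0 ≤ (edist a b).toReal := ENNReal.toReal_nonneg
  -- An infinite distance has `toReal` equal to `0`.
  by_cases hxy : edist x y = ⊤
  · rw [hxy, ENNReal.toReal_top]
    linarith
  have hab : edist a b ≠ ⊤ := by
    refine ne_top_of_le_ne_top ?_ ((edist_triangle a x b).trans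
      (add_le_add le_rfl (edist_triangle x y b)))
    rw [edist_comm a x]
    exact ENNReal.add_ne_top.2 ⟨(hxa.trans ENNReal.one_lt_top).ne,
      ENNReal.add_ne_top.2 ⟨hxy, (hyb.trans ENNReal.one_lt_top).ne⟩⟩
  have h3 : edist x y ≤ 1 + (edist a b + 1) :=
    (edist_triangle x a y).trans (add_le_add hxa.le ((edist_triangle a b y).trans
      (add_le_add le_rfl (by rw [edist_comm]; exact hyb.le))))
  have h4 := ENNReal.toReal_mono (by finiteness) h3
  rw [ENNReal.toReal_add (by finiteness) (by finiteness), ENNReal.toReal_add hab (by finiteness),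
    ENNReal.toReal_one] at h4
  linarith

namespace IsPiecewiseExpandingMarkov

open Classical in
/-- The element of the partition `P` which contains a point. -/
def label {M : Type*} (P : Set (Set M)) (x : M) : Option P :=
  if h : ∃ U : P, x ∈ (U : Set M) then some h.choose else none

theorem label_eq_none_iff {M : Type*} {P : Set (Set M)} {x : M} :
    label P x = none ↔ x ∉ ⋃₀ P := by
  by_cases h : ∃ U : P, x ∈ (U : Set M)
  · simp only [label, dif_pos h, reduceCtorEq, false_iff, not_not]
    exact ⟨h.choose, h.choose.2, h.choose_spec⟩
  · simp only [label, dif_neg h, true_iff]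
    rintro ⟨U, hU, hx⟩
    exact h ⟨⟨U, hU⟩, hx⟩

theorem label_preimage_some {M : Type*} {P : Set (Set M)} (hP : P.PairwiseDisjoint id) (U : P) :
    label P ⁻¹' {some U} = U := by
  have key : ∀ x, (h : ∃ V : P, x ∈ (V : Set M)) → x ∈ (U : Set M) → h.choose = U :=
    fun x h hx => Subtype.ext (hP.elim_set h.choose.2 U.2 x h.choose_spec hx)
  ext x
  simp only [mem_preimage, mem_singleton_iff]
  constructor
  · intro hx
    by_cases h : ∃ V : P, x ∈ (V : Set M)
    · rw [label, dif_pos h, Option.some_inj] at hx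
      exact hx ▸ h.choose_spec
    · simp [label, dif_neg h] at hx
  · intro hx
    have h : ∃ V : P, x ∈ (V : Set M) := ⟨U, hx⟩
    rw [label, dif_pos h, key x h hx]

open Classical in
/-- The Jacobian, with the value `1` outside of the elements of the partition. -/
def jacobian (d : ℕ) {M : Type*} [EMetricSpace M] [ChartedSpace (EuclideanSpace ℝ (Fin d)) M]
    [RiemannianBundle (fun x : M => TangentSpace (𝓡 d) x)] (F : M → M) (P : Set (Set M)) : M → ℝ :=
  (⋃₀ P).piecewise (riemannianJacobian d F) 1

theorem jacobian_of_mem {d : ℕ} {M : Type*} [EMetricSpace M]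
    [ChartedSpace (EuclideanSpace ℝ (Fin d)) M]
    [RiemannianBundle (fun x : M => TangentSpace (𝓡 d) x)] {F : M → M} {P : Set (Set M)} {x : M} (hx : x ∈ ⋃₀ P) :
    jacobian d F P x = riemannianJacobian d F x := by
  classical exact Set.piecewise_eq_of_mem _ _ _ hx

variable {d : ℕ} {M : Type*} [EMetricSpace M] [ChartedSpace (EuclideanSpace ℝ (Fin d)) M]
  [RiemannianBundle (fun x : M => TangentSpace (𝓡 d) x)] [MeasurableSpace M]
  {F : M → M} {Δ : Set M} {P : Set (Set M)}

theorem isOpen (hF : IsPiecewiseExpandingMarkov d F Δ P) {U : Set M} (hU : U ∈ P) : IsOpen U := by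
  obtain ⟨Φ, rfl, -, -⟩ := hF.markov U hU
  exact Φ.open_source

theorem isPreconnected_disk (hF : IsPiecewiseExpandingMarkov d F Δ P) : IsPreconnected Δ := by
  obtain ⟨e⟩ := hF.disk
  have h : IsPreconnected (Metric.ball (0 : EuclideanSpace ℝ (Fin d)) 1) :=
    (convex_ball _ _).isPreconnected
  rw [isPreconnected_iff_preconnectedSpace] at h ⊢
  exact e.symm.surjective.denseRange.preconnectedSpace e.symm.continuous

theorem one_le_riemannianJacobian (hF : IsPiecewiseExpandingMarkov d F Δ P) {x : M}
    (hx : x ∈ ⋃₀ P) : 1 ≤ riemannianJacobian d F x := by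
  obtain ⟨U, hU, hxU⟩ := hx
  obtain ⟨κ, -, hκ1, hκ⟩ := hF.expansion
  obtain ⟨Φ, rfl, -, hΦ⟩ := hF.markov U hU
  exact Φ.one_le_riemannianJacobian hΦ (fun y hy => (hκ _ hU y hy).trans hκ1) hxU

theorem ae_mem (hF : IsPiecewiseExpandingMarkov d F Δ P) [BorelSpace M] :
    ∀ᵐ x ∂(riemannianVolume d M).restrict Δ, x ∈ ⋃₀ P := by
  rw [ae_restrict_iff' hF.isOpen_disk.measurableSet, ae_iff]
  convert hF.full_measure using 2
  ext x
  simp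

theorem isFullBranchMap (hF : IsPiecewiseExpandingMarkov d F Δ P) [BorelSpace M]
    [SecondCountableTopology M] [IsManifold (𝓡 d) 1 M]
    [IsContinuousRiemannianBundle (EuclideanSpace ℝ (Fin d))
      (fun x : M => TangentSpace (𝓡 d) x)] [MeasurableSpace (Option P)]
    [DiscreteMeasurableSpace (Option P)] (hFm : Measurable F) :
    IsFullBranchMap ((riemannianVolume d M).restrict Δ) F (label P) {none}ᶜ
      (jacobian d F P) := by
  have := hF.countable.to_subtype
  have hPo : IsOpen (⋃₀ P) := isOpen_sUnion fun U hU => hF.isOpen hU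
  have hΔ := hF.isOpen_disk.measurableSet
  have hsome : ∀ {l : Option P}, l ∈ ({none}ᶜ : Set (Option P)) → ∃ U, l = some U :=
    fun hl => Option.ne_none_iff_exists'.1 hl
  have hmem : ∀ {x}, label P x ∈ ({none}ᶜ : Set (Option P)) ↔ x ∈ ⋃₀ P := fun {x} => by
    rw [mem_compl_iff, mem_singleton_iff, label_eq_none_iff, not_not]
  have hJm : Measurable (jacobian d F P) := by
    classical
    refine ContinuousOn.measurable_piecewise (continuousOn_riemannianJacobian hPo ?_)
      continuousOn_const hPo.measurableSet
    rintro x ⟨U, hU, hxU⟩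
    obtain ⟨Φ, rfl, -, hΦ⟩ := hF.markov U hU
    exact (((Φ.contMDiffOn_toFun.of_le one_le_two).congr hΦ x hxU).contMDiffAt
      (Φ.open_source.mem_nhds hxU)).contMDiffWithinAt
  refine ⟨hFm, ?_, hJm, ?_, ?_, ?_, ?_⟩
  · refine measurable_to_countable' fun l => ?_
    cases l with
    | none =>
      have : label P ⁻¹' {none} = (⋃₀ P)ᶜ := by
        ext x
        exact label_eq_none_iff
      rw [this]
      exact hPo.measurableSet.compl
    | some U =>
      rw [label_preimage_some hF.disjoint]
      exact (hF.isOpen U.2).measurableSet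
  · intro x hx
    rw [jacobian_of_mem (hmem.1 hx)]
    exact hF.one_le_riemannianJacobian (hmem.1 hx)
  · filter_upwards [hF.ae_mem] with x hx using hmem.2 hx
  · intro l hl
    obtain ⟨U, rfl⟩ := hsome hl
    rw [label_preimage_some hF.disjoint]
    obtain ⟨Φ, hs, -, hΦ⟩ := hF.markov U U.2
    exact (hs ▸ Φ.injOn).congr hΦ.symm
  · intro l hl g hg
    obtain ⟨U, rfl⟩ := hsome hl
    rw [label_preimage_some hF.disjoint]
    obtain ⟨Φ, hs, ht, hΦ⟩ := hF.markov U U.2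
    have hUm : MeasurableSet (U : Set M) := (hF.isOpen U.2).measurableSet
    have hJ : Measurable fun x => ENNReal.ofReal (jacobian d F P x) := hJm.ennreal_ofReal
    -- The branch formula says that `F` pushes `J · m` on `U` forward to `m` on `Δ`. On sets this is
    -- the change of variables formula, since `F` maps `F⁻¹ B ∩ U` onto `B ∩ Δ`.
    have hmap : Measure.map F (((riemannianVolume d M).restrict U).withDensity
        fun x => ENNReal.ofReal (jacobian d F P x)) = (riemannianVolume d M).restrict Δ := by
      ext B hB
      have hBm : MeasurableSet (F ⁻¹' B ∩ U) := (hFm hB).inter hUm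
      have himg : F '' (F ⁻¹' B ∩ U) = B ∩ Δ := by
        rw [image_preimage_inter, hΦ.image_eq, ← hs, ← ht]
        exact congrArg (B ∩ ·) Φ.image_source_eq_target
      rw [Measure.map_apply hFm hB, withDensity_apply _ (hFm hB),
        Measure.restrict_restrict (hFm hB), Measure.restrict_apply hB, ← himg]
      refine (riemannianVolume_image Φ hFm (hs ▸ hΦ) hJ (fun x hx => ?_) hBm
        (hs ▸ inter_subset_right)).symm
      rw [jacobian_of_mem ⟨U, U.2, hs ▸ hx⟩]
    rw [Measure.restrict_restrict hUm, inter_eq_left.2 (hF.subset U U.2), ← hmap,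
      lintegral_map hg hFm]
    exact (lintegral_withDensity_eq_lintegral_mul _ hJ (hg.comp hFm)).symm

theorem exists_jacobian_le (hF : IsPiecewiseExpandingMarkov d F Δ P) :
    ∃ K, 0 ≤ K ∧ ∀ x y, label P x ∈ ({none}ᶜ : Set (Option P)) → label P x = label P y →
      jacobian d F P y ≤ jacobian d F P x * (1 + K * (edist (F x) (F y)).toReal) := by
  obtain ⟨K, hK, hdist⟩ := hF.distortion
  refine ⟨K, hK.le, fun x y hx hxy => ?_⟩
  obtain ⟨U, hU⟩ := Option.ne_none_iff_exists'.1 hx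
  have hxU : x ∈ (U : Set M) := label_preimage_some hF.disjoint U ▸ hU
  have hyU : y ∈ (U : Set M) := label_preimage_some hF.disjoint U ▸ (hxy.symm.trans hU)
  have hxP : x ∈ ⋃₀ P := ⟨U, U.2, hxU⟩
  have hyP : y ∈ ⋃₀ P := ⟨U, U.2, hyU⟩
  rw [jacobian_of_mem hxP, jacobian_of_mem hyP]
  -- The points are swapped, so that `J x` becomes the denominator.
  have h1 := (abs_le.1 (hdist U U.2 y hyU x hxU)).2
  have h2 : 0 < riemannianJacobian d F x := one_pos.trans_le (hF.one_le_riemannianJacobian hxP)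
  rw [edist_comm, sub_le_iff_le_add, div_le_iff₀ h2] at h1
  linarith

end IsPiecewiseExpandingMarkov

end

theorem mainTheorem5 (d : ℕ) {M : Type*} [EMetricSpace M] [CompactSpace M]
    [ChartedSpace (EuclideanSpace ℝ (Fin d)) M] [IsManifold (𝓡 d) ∞ M]
    [RiemannianBundle (fun x : M => TangentSpace (𝓡 d) x)]
    [IsContMDiffRiemannianBundle (𝓡 d) ∞ (EuclideanSpace ℝ (Fin d))
      (fun x : M => TangentSpace (𝓡 d) x)]
    [IsRiemannianManifold (𝓡 d) M] [MeasurableSpace M] [BorelSpace M]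
    (F : M → M) (Δ : Set M) (P : Set (Set M)) (hF : IsPiecewiseExpandingMarkov d F Δ P)
    (μ : Measure M) [IsProbabilityMeasure μ]
    (hac : μ ≪ (riemannianVolume d M).restrict Δ) (hinv : MeasurePreserving F μ μ) :
    (∀ᵐ x ∂μ, 0 ≤ Real.log (riemannianJacobian d F x)) ∧
      metricEntropy μ F = ∫⁻ x in Δ, ENNReal.ofReal (Real.log (riemannianJacobian d F x)) ∂μ := by
  have hmem : ∀ᵐ x ∂μ, x ∈ ⋃₀ P := hac.ae_le hF.ae_mem
  refine ⟨?_, ?_⟩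
  · filter_upwards [hmem] with x hx using Real.log_nonneg (hF.one_le_riemannianJacobian hx)
  have hcont : IsContinuousRiemannianBundle (EuclideanSpace ℝ (Fin d))
      (fun x : M => TangentSpace (𝓡 d) x) := by
    obtain ⟨g, hg, hgi⟩ := IsContMDiffRiemannianBundle.exists_contMDiff (IB := 𝓡 d) (n := ∞)
      (F := EuclideanSpace ℝ (Fin d)) (E := fun x : M => TangentSpace (𝓡 d) x)
    exact ⟨g, hg.continuous, hgi⟩
  have := hF.countable.to_subtype
  let _ : MeasurableSpace (Option P) := ⊤
  have hdisc : DiscreteMeasurableSpace (Option P) := ⟨fun _ => trivial⟩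
  -- Since `M` is compact, local finiteness makes the volume finite.
  have hlf := isLocallyFiniteMeasure_riemannianVolume (d := d) (M := M)
  have hΔc : μ Δᶜ = 0 := hac (by
    rw [Measure.restrict_apply hF.isOpen_disk.measurableSet.compl, compl_inter_self,
      measure_empty])
  obtain ⟨κ, hκ0, hκ1, hκ⟩ := hF.expansion
  obtain ⟨K, hK, hdist⟩ := hF.exists_jacobian_le
  obtain ⟨D, hD⟩ := exists_forall_edist_toReal_le M
  have hpre : ∀ l ∈ ({none}ᶜ : Set (Option P)), ∃ U ∈ P,
      IsPiecewiseExpandingMarkov.label P ⁻¹' {l} = U := fun l hl => by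
    obtain ⟨U, rfl⟩ := Option.ne_none_iff_exists'.1 hl
    exact ⟨U, U.2, IsPiecewiseExpandingMarkov.label_preimage_some hF.disjoint U⟩
  have hmain := (hF.isFullBranchMap hinv.measurable).metricEntropy_eq hac hinv hκ0 hκ1 hK hD hdist
    fun ε hε => by
      -- Inner regularity of `μ` on `Δ`; the closed set `Q` is compact because `M` is.
      obtain ⟨Q, hQΔ, hQ, hlt⟩ := hF.isOpen_disk.measurableSet.exists_isClosed_sdiff_lt
        (measure_ne_top μ Δ) (ENNReal.ofReal_pos.2 hε).ne'
      refine ⟨Q, hQ.measurableSet, ?_, contractsOn_of_isCompact (d := d) hF.isOpen_disk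
        hF.isPreconnected_disk ?_ ?_ hκ0 ?_ hQ.isCompact hQΔ⟩
      · refine ENNReal.toReal_le_of_le_ofReal hε.le ?_
        calc μ Qᶜ ≤ μ (Δ \ Q) + μ Δᶜ := by
              refine (measure_mono fun x hx => ?_).trans (measure_union_le _ _)
              by_cases h : x ∈ Δ
              · exact Or.inl ⟨h, hx⟩
              · exact Or.inr h
          _ ≤ ENNReal.ofReal ε := by
              rw [hΔc, add_zero]
              exact hlt.le
      · intro l hl
        obtain ⟨U, hU, h⟩ := hpre l hl
        exact h ▸ hF.subset U hU
      · intro l hl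
        obtain ⟨U, hU, h⟩ := hpre l hl
        exact h ▸ hF.markov U hU
      · intro l hl
        obtain ⟨U, hU, h⟩ := hpre l hl
        exact h ▸ hκ U hU
  -- `μ` is carried by `Δ`, and almost everywhere the modified Jacobian is the true one.
  rw [hmain, Measure.restrict_eq_self_of_ae_mem (mem_ae_iff.2 hΔc)]
  refine lintegral_congr_ae ?_
  filter_upwards [hmem] with x hx
  rw [IsPiecewiseExpandingMarkov.jacobian_of_mem hx]
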